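/- Let $\mathbb K$ be an algebraically closed field of characteristic $0$ and $I$ a finite set. Let $A=(A_{ij})_{i,j\in I}$ be an invertible generalised Cartan matrix, and let $\epsilon_i\in\mathbb K$ ($i\in I$) be nonzero numbers such that $D^{-1}A$ is symmetric, where $D=\mathrm{diag}(\epsilon_i)$. Let $\mathfrak g=\mathfrak g(A)$ be the Kac--Moody algebra with Chevalley generators $e_i,f_i,h_i$, so that $[h_i,e_j]=A_{ij}e_j$, and let $\kappa$ be the invariant symmetric bilinear form on $\mathfrak g$ with $\kappa(e_i,f_j)=\delta_{ij}\epsilon_j$. Let $\lambda$ be a dominant integral weight with Dynkin labels $\lambda_i\in\mathbb Z_{\ge0}$, and put $K=\{i\in I:\lambda_i=0\}$, $J=I\setminus K$. Let $B=(B_{ij})_{i,j\in\{0\}\cup I}$ be given by $B_{00}=0$, $B_{i0}=-\lambda_i$, $B_{0j}=-\lambda_j/\epsilon_j$, $B_{ij}=A_{ij}$ ($i,j\in I$). Assume that $B$ and $(A_{kl})_{k,l\in K}$ are invertible. Let $\tilde W$ be the Lie superalgebra with generators $e_i,h_i$ ($i\in\{0\}\cup I$), $f_i$ ($i\in I$),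 $f_{0i}$ ($i\in\{0\}\cup K$), where $e_0$ and the $f_{0i}$ are odd and the other generators even, and with the relations $$[e_i,f_j]=\delta_{ij}h_j,\quad [h_i,f_j]=-B_{ij}f_j,\quad [h_i,e_j]=B_{ij}e_j,\quad [e_0,f_{0i}]=h_i,\quad [h_i,f_{0j}]=-B_{i0}f_{0j},$$ $$(\mathrm{ad}\,e_i)^{1-B_{ij}}(e_j)=(\mathrm{ad}\,f_i)^{1-B_{ij}}(f_j)=0$$ for all indices for which the generators are defined (the last two whenever $1-B_{ij}$ is a positive integer), and, for all $j\in J$, $k,l\in K$, $i\in\{0\}\cup K$, $$[e_k,[f_l,f_{0i}]]=\delta_{kl}B_{il}f_{0k},\quad (\mathrm{ad}\,f_j)^{1-B_{j0}}(f_{0i})=[e_j,f_{0i}]=0,$$ $$[e_k,[e_k,f_{0i}]]=[f_k,[f_k,f_{0i}]]=0,\quad [e_j,[e_k,f_{0i}]]=0.$$ Give $\tilde W$ the $\mathbb Z$-grading in which $e_0$ has degree $1$, the $f_{0i}$ have degree $-1$ and all other generators have degree $0$. Let $W$ be the quotient of $\tilde W$ by the maximal graded ideal which intersects the sum of the subspaces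 of degrees $-1,0,1$ trivially. Elements of $\mathfrak g$ are regarded as elements of $W$ through the homomorphism $\mathfrak g\to W$ that sends $e_i,f_i,h_i$ to $e_i,f_i,h_i$. Let $\mathfrak g^-\subseteq\mathfrak g$ be the subalgebra generated by $e_k,f_k,h_k$ ($k\in K$), with Cartan subalgebra $\mathfrak h^-$ spanned by the $h_k$, and with simple roots $\alpha_k$, where $\alpha_k(h_l)=A_{lk}$. By weights of $\mathfrak g^-$ we mean elements of $(\mathfrak h^-)^*$. Let $\varphi:\mathfrak h^-\to(\mathfrak h^-)^*$ be given by $\varphi(h)(h')=\kappa(h,h')$, and put $(\mu,\nu)=\kappa(\varphi^{-1}(\mu),\varphi^{-1}(\nu))$. The weights $\alpha_k{}^\vee=\epsilon_k\alpha_k=\varphi(h_k)$ form a basis of $(\mathfrak h^-)^*$; for a weight $\mu=\sum_{k\in K}c_k\alpha_k{}^\vee$ set $f_{0\mu^\vee}=\sum_{k\in K}c_kf_{0k}$. A real root of $\mathfrak g^-$ is a root in the orbit of a simple root under the Weyl group of $\mathfrak g^-$. **Proposition.** Let $\alpha$ be a real root of $\mathfrak g^-$, let $e_{\alpha}$ and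 $e_{-\alpha}$ be root vectors of $\mathfrak g^-$ for $\alpha$ and $-\alpha$, and let $\mu,\nu$ be weights of $\mathfrak g^-$. Then in $W$ $$[e_\alpha,[e_\alpha,f_{0\mu^\vee}]]=0,$$ $$[e_\alpha,[e_{-\alpha},f_{0\mu^\vee}]]=(\mu,\alpha)\,\kappa(e_\alpha,e_{-\alpha})\,f_{0\alpha^\vee},$$ $$(\mu,\alpha)[e_\alpha,f_{0\nu^\vee}]=(\nu,\alpha)[e_\alpha,f_{0\mu^\vee}].$$ Here $f_{0\alpha^\vee}$ denotes $f_{0\mu^\vee}$ for $\mu=\alpha$; thus the second right-hand side is $(\mu,\alpha)f_{0\alpha^\vee}$ when $\kappa(e_\alpha,e_{-\alpha})=1$, and $(\mu,\alpha_k)f_{0k}$ when $e_{\alpha}=e_k$, $e_{-\alpha}=f_k$. -/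

import Mathlib

noncomputable section

namespace THA

/-! ### Lie superalgebras with a consistent grading -/

section Super

/-- The sign `(-1)^{ab}` attached to homogeneous elements of degrees `a` and `b`; the parity of a
homogeneous element is the parity of its degree (the grading is consistent). -/
def sgn (𝕂 : Type*) [Field 𝕂] (a b : ℤ) : 𝕂 :=
  open scoped Classical in if Odd a ∧ Odd b then -1 else 1

/-- A vector space spanned by subspaces `piece n` (`n : ℤ`), with a bilinear bracket which respects
the degrees and satisfies the axioms of a Lie superalgebra, where the elements of `piece n` are even
or odd according to the parity of `n`. -/
structure SuperLie (𝕂 L : Type*) [Field 𝕂] [AddCommGroup L] [Module 𝕂 L] where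
  bracket : L →ₗ[𝕂] L →ₗ[𝕂] L
  piece : ℤ → Submodule 𝕂 L
  iSup_piece : ⨆ n, piece n = ⊤
  bracket_mem : ∀ {m n : ℤ} {x y : L}, x ∈ piece m → y ∈ piece n → bracket x y ∈ piece (m + n)
  skew : ∀ {m n : ℤ} {x y : L}, x ∈ piece m → y ∈ piece n →
    bracket x y = -(sgn 𝕂 m n • bracket y x)
  jacobi : ∀ {m n : ℤ} {x y : L} (z : L), x ∈ piece m → y ∈ piece n →
    bracket x (bracket y z) = bracket (bracket x y) z + sgn 𝕂 m n • bracket y (bracket x z)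

variable {𝕂 L : Type*} [Field 𝕂] [AddCommGroup L] [Module 𝕂 L]

/-- Two-sided ideals with respect to a bilinear product. -/
def IsIdeal (b : L →ₗ[𝕂] L →ₗ[𝕂] L) (I : Submodule 𝕂 L) : Prop :=
  ∀ x, ∀ y ∈ I, b x y ∈ I ∧ b y x ∈ I

/-- The product induced on the quotient by an ideal. -/
def quotBracket (b : L →ₗ[𝕂] L →ₗ[𝕂] L) (I : Submodule 𝕂 L) (hI : IsIdeal b I) :
    (L ⧸ I) →ₗ[𝕂] (L ⧸ I) →ₗ[𝕂] (L ⧸ I) :=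
  I.liftQ (I.liftQ (b.compr₂ I.mkQ).flip (by
      intro y hy
      rw [LinearMap.mem_ker]
      ext x
      simpa using (hI x y hy).1)).flip (by
    intro x hx
    rw [LinearMap.mem_ker]
    ext y
    simpa using (hI y x hx).2)

@[simp] theorem quotBracket_mk (b : L →ₗ[𝕂] L →ₗ[𝕂] L) (I : Submodule 𝕂 L) (hI : IsIdeal b I)
    (x y : L) : quotBracket b I hI (I.mkQ x) (I.mkQ y) = I.mkQ (b x y) := rfl

namespace SuperLie

/-- The quotient of a Lie superalgebra by an ideal, with the image grading. -/
def quot (S : SuperLie 𝕂 L) (I : Submodule 𝕂 L) (hI : IsIdeal S.bracket I) :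
    SuperLie 𝕂 (L ⧸ I) where
  bracket := quotBracket S.bracket I hI
  piece n := (S.piece n).map I.mkQ
  iSup_piece := by
    rw [← Submodule.map_iSup, S.iSup_piece, Submodule.map_top, Submodule.range_mkQ]
  bracket_mem := by
    rintro m n _ _ ⟨x, hx, rfl⟩ ⟨y, hy, rfl⟩
    exact ⟨_, S.bracket_mem hx hy, rfl⟩
  skew := by
    rintro m n _ _ ⟨x, hx, rfl⟩ ⟨y, hy, rfl⟩
    rw [quotBracket_mk, quotBracket_mk, S.skew hx hy, map_neg, map_smul]
  jacobi := by
    rintro m n _ _ z ⟨x, hx, rfl⟩ ⟨y, hy, rfl⟩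
    obtain ⟨z, rfl⟩ := I.mkQ_surjective z
    simp only [quotBracket_mk]
    rw [S.jacobi z hx hy, map_add, map_smul]

/-- The local part: the sum of the subspaces of degrees `-1`, `0` and `1`. -/
def localPart (S : SuperLie 𝕂 L) : Submodule 𝕂 L := S.piece (-1) ⊔ S.piece 0 ⊔ S.piece 1

/-- The graded ideals which intersect the local part trivially. -/
def peripheralIdeals (S : SuperLie 𝕂 L) : Set (Submodule 𝕂 L) :=
  {I | IsIdeal S.bracket I ∧ I ≤ ⨆ n, I ⊓ S.piece n ∧ I ⊓ S.localPart = ⊥}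

/-- The maximal graded ideal which intersects the local part trivially. -/
def maxIdeal (S : SuperLie 𝕂 L) : Submodule 𝕂 L := sSup S.peripheralIdeals

theorem isIdeal_maxIdeal (S : SuperLie 𝕂 L) : IsIdeal S.bracket S.maxIdeal := by
  intro x y hy
  have h1 : S.maxIdeal ≤ S.maxIdeal.comap (S.bracket x) :=
    sSup_le fun I hI z hz => (le_sSup hI : I ≤ S.maxIdeal) (hI.1 x z hz).1
  have h2 : S.maxIdeal ≤ S.maxIdeal.comap (S.bracket.flip x) :=
    sSup_le fun I hI z hz => (le_sSup hI : I ≤ S.maxIdeal) (hI.1 x z hz).2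
  exact ⟨h1 hy, h2 hy⟩

/-- The minimal Lie superalgebra with the same local part. -/
def minimal (S : SuperLie 𝕂 L) : SuperLie 𝕂 (L ⧸ S.maxIdeal) :=
  S.quot S.maxIdeal S.isIdeal_maxIdeal

theorem zero_skew (S : SuperLie 𝕂 L) {x y : L} (hx : x ∈ S.piece 0) (hy : y ∈ S.piece 0) :
    S.bracket x y = -S.bracket y x := by
  simpa [sgn] using S.skew hx hy

/-- The subspace of degree `0` is a Lie algebra. -/
instance zeroLieRing [CharZero 𝕂] (S : SuperLie 𝕂 L) : LieRing (S.piece 0) where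
  bracket x y := ⟨S.bracket x y, by simpa using S.bracket_mem x.2 y.2⟩
  add_lie x y z := by ext; simp
  lie_add x y z := by ext; simp
  lie_self x := by
    ext
    have h : (2 : 𝕂) • S.bracket x x = 0 := by
      rw [two_smul]
      nth_rewrite 1 [S.zero_skew x.2 x.2]
      simp
    simpa using h
  leibniz_lie x y z := by
    ext
    simpa [sgn] using S.jacobi z.1 x.2 y.2

instance zeroLieAlgebra [CharZero 𝕂] (S : SuperLie 𝕂 L) : LieAlgebra 𝕂 (S.piece 0) where
  lie_smul t x y := by
    ext
    exact map_smul (S.bracket x.1) t y.1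

theorem coe_zero_lie [CharZero 𝕂] (S : SuperLie 𝕂 L) (x y : S.piece 0) :
    ((⁅x, y⁆ : S.piece 0) : L) = S.bracket x y := rfl

end SuperLie

end Super

/-! ### Lie superalgebras given by generators and relations -/

section Presentation

variable {𝕂 X : Type*} [Field 𝕂]

/-- The degree of a monomial, given the degrees of the generators. -/
def deg (d : X → ℤ) : FreeMagma X → ℤ
  | .of x => d x
  | .mul a b => deg d a + deg d b

/-- A monomial, as an element of the free non-associative algebra. -/
def mono (𝕂 : Type*) [Field 𝕂] (m : FreeMagma X) : FreeNonUnitalNonAssocAlgebra 𝕂 X :=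
  MonoidAlgebra.single m 1

theorem mono_mul (a b : FreeMagma X) : mono 𝕂 (a * b) = mono 𝕂 a * mono 𝕂 b := by
  simp [mono]

/-- Equations defining a Lie superalgebra: those of a presentation `R`, and graded skew symmetry
and the graded Jacobi identity for all monomials. -/
inductive PresRel (d : X → ℤ)
    (R : FreeNonUnitalNonAssocAlgebra 𝕂 X → FreeNonUnitalNonAssocAlgebra 𝕂 X → Prop) :
    FreeNonUnitalNonAssocAlgebra 𝕂 X → FreeNonUnitalNonAssocAlgebra 𝕂 X → Prop
  | skew (a b : FreeMagma X) : PresRel d R (mono 𝕂 a * mono 𝕂 b)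
      (-(sgn 𝕂 (deg d a) (deg d b) • (mono 𝕂 b * mono 𝕂 a)))
  | jacobi (a b c : FreeMagma X) : PresRel d R (mono 𝕂 a * (mono 𝕂 b * mono 𝕂 c))
      (mono 𝕂 a * mono 𝕂 b * mono 𝕂 c +
        sgn 𝕂 (deg d a) (deg d b) • (mono 𝕂 b * (mono 𝕂 a * mono 𝕂 c)))
  | rel {x y : FreeNonUnitalNonAssocAlgebra 𝕂 X} : R x y → PresRel d R x y

/-- The ideal of the free non-associative algebra generated by the differences `x - y` of the two
sides of all these equations. -/
def presIdeal (d : X → ℤ)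
    (R : FreeNonUnitalNonAssocAlgebra 𝕂 X → FreeNonUnitalNonAssocAlgebra 𝕂 X → Prop) :
    Submodule 𝕂 (FreeNonUnitalNonAssocAlgebra 𝕂 X) :=
  sInf {I | IsIdeal (LinearMap.mul 𝕂 (FreeNonUnitalNonAssocAlgebra 𝕂 X)) I ∧
    ∀ x y, PresRel d R x y → x - y ∈ I}

theorem isIdeal_presIdeal (d : X → ℤ)
    (R : FreeNonUnitalNonAssocAlgebra 𝕂 X → FreeNonUnitalNonAssocAlgebra 𝕂 X → Prop) :
    IsIdeal (LinearMap.mul 𝕂 (FreeNonUnitalNonAssocAlgebra 𝕂 X)) (presIdeal d R) := by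
  intro x y hy
  simp only [presIdeal, Submodule.mem_sInf] at hy ⊢
  exact ⟨fun I hI => (hI.1 x y (hy I hI)).1, fun I hI => (hI.1 x y (hy I hI)).2⟩

theorem mk_eq_of_rel {d : X → ℤ}
    {R : FreeNonUnitalNonAssocAlgebra 𝕂 X → FreeNonUnitalNonAssocAlgebra 𝕂 X → Prop}
    {x y : FreeNonUnitalNonAssocAlgebra 𝕂 X} (h : PresRel d R x y) :
    (presIdeal d R).mkQ x = (presIdeal d R).mkQ y := by
  rw [← sub_eq_zero, ← map_sub, Submodule.mkQ_apply, Submodule.Quotient.mk_eq_zero]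
  exact (Submodule.mem_sInf).2 fun I hI => hI.2 x y h

theorem span_mono : Submodule.span 𝕂 (Set.range (mono (X := X) 𝕂)) = ⊤ := by
  rw [eq_top_iff]
  rintro x -
  induction x using MonoidAlgebra.induction_linear with
  | zero => exact zero_mem _
  | add x y hx hy => exact add_mem hx hy
  | single m r =>
    have : MonoidAlgebra.single m r = r • mono 𝕂 m := by simp [mono]
    rw [this]
    exact Submodule.smul_mem _ _ (Submodule.subset_span ⟨m, rfl⟩)

/-- The Lie superalgebra generated by `X` modulo the relations `R`. The element `x : X` is
homogeneous of degree `d x`; the relations are meant to be homogeneous. -/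
def presented (d : X → ℤ)
    (R : FreeNonUnitalNonAssocAlgebra 𝕂 X → FreeNonUnitalNonAssocAlgebra 𝕂 X → Prop) :
    SuperLie 𝕂 (FreeNonUnitalNonAssocAlgebra 𝕂 X ⧸ presIdeal d R) where
  bracket := quotBracket _ _ (isIdeal_presIdeal d R)
  piece n := (Submodule.span 𝕂 (mono 𝕂 '' {m | deg d m = n})).map (presIdeal d R).mkQ
  iSup_piece := by
    rw [← Submodule.map_iSup, ← Submodule.span_iUnion, ← Set.image_iUnion]
    have : (⋃ n, {m : FreeMagma X | deg d m = n}) = Set.univ := by ext m; simp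
    rw [this, Set.image_univ, span_mono, Submodule.map_top, Submodule.range_mkQ]
  bracket_mem := by
    rintro m n _ _ ⟨x, hx, rfl⟩ ⟨y, hy, rfl⟩
    refine ⟨x * y, ?_, rfl⟩
    simp only [SetLike.mem_coe] at hx hy ⊢
    induction hx, hy using Submodule.span_induction₂ with
    | mem_mem x y hx hy =>
      obtain ⟨a, ha, rfl⟩ := hx
      obtain ⟨b, hb, rfl⟩ := hy
      rw [← mono_mul]
      refine Submodule.subset_span ⟨a * b, ?_, rfl⟩
      change deg d a + deg d b = m + n
      rw [ha, hb]
    | zero_left y hy => simp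
    | zero_right x hx => simp
    | add_left x y z _ _ _ h1 h2 => rw [add_mul]; exact add_mem h1 h2
    | add_right x y z _ _ _ h1 h2 => rw [mul_add]; exact add_mem h1 h2
    | smul_left r x y _ _ h => rw [smul_mul_assoc]; exact Submodule.smul_mem _ _ h
    | smul_right r x y _ _ h => rw [mul_smul_comm]; exact Submodule.smul_mem _ _ h
  skew := by
    rintro m n _ _ ⟨x, hx, rfl⟩ ⟨y, hy, rfl⟩
    simp only [SetLike.mem_coe] at hx hy
    induction hx, hy using Submodule.span_induction₂ with
    | mem_mem x y hx hy =>
      obtain ⟨a, rfl, rfl⟩ := hx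
      obtain ⟨b, rfl, rfl⟩ := hy
      have h := mk_eq_of_rel (PresRel.skew (d := d) (R := R) a b)
      rw [map_neg, map_smul] at h
      exact h
    | zero_left y hy => simp
    | zero_right x hx => simp
    | add_left x y z _ _ _ h1 h2 => simp only [map_add, LinearMap.add_apply, h1, h2]; module
    | add_right x y z _ _ _ h1 h2 => simp only [map_add, LinearMap.add_apply, h1, h2]; module
    | smul_left r x y _ _ h => simp only [map_smul, LinearMap.smul_apply, h]; module
    | smul_right r x y _ _ h => simp only [map_smul, LinearMap.smul_apply, h]; module
  jacobi := by
    rintro m n _ _ z ⟨x, hx, rfl⟩ ⟨y, hy, rfl⟩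
    simp only [SetLike.mem_coe] at hx hy
    induction hx, hy using Submodule.span_induction₂ with
    | mem_mem x y hx hy =>
      obtain ⟨a, rfl, rfl⟩ := hx
      obtain ⟨b, rfl, rfl⟩ := hy
      obtain ⟨z, rfl⟩ := (presIdeal d R).mkQ_surjective z
      have hz : z ∈ Submodule.span 𝕂 (Set.range (mono (X := X) 𝕂)) := by
        rw [span_mono]; trivial
      induction hz using Submodule.span_induction with
      | mem z hz =>
        obtain ⟨c, rfl⟩ := hz
        have h := mk_eq_of_rel (PresRel.jacobi (d := d) (R := R) a b c)
        rw [map_add, map_smul] at h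
        exact h
      | zero => simp
      | add x y _ _ h1 h2 => simp only [map_add, h1, h2]; module
      | smul r x _ h => simp only [map_smul, h]; module
    | zero_left y hy => simp
    | zero_right x hx => simp
    | add_left x y z _ _ _ h1 h2 => simp only [map_add, LinearMap.add_apply, h1, h2]; module
    | add_right x y z _ _ _ h1 h2 => simp only [map_add, LinearMap.add_apply, h1, h2]; module
    | smul_left r x y _ _ h => simp only [map_smul, LinearMap.smul_apply, h]; module
    | smul_right r x y _ _ h => simp only [map_smul, LinearMap.smul_apply, h]; module

end Presentation

/-! ### The initial data -/

/-- The extended matrix `B`, with rows and columns indexed by `{0} ∪ I` (here `0` is `none`):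
`B_{00} = 0`, `B_{i0} = -λ_i`, `B_{0j} = -λ_j / ε_j`, `B_{ij} = A_{ij}`. -/
def extendedMatrix {𝕂 ι : Type*} [Field 𝕂] (A : Matrix ι ι ℤ) (ε : ι → 𝕂) (wt : ι → ℕ) :
    Matrix (Option ι) (Option ι) 𝕂 := Matrix.of fun i j => match i, j with
  | none, none => 0
  | some i, none => -(wt i : 𝕂)
  | none, some j => -((ε j)⁻¹ * (wt j : 𝕂))
  | some i, some j => (A i j : 𝕂)

/-- A symmetrisable invertible generalised Cartan matrix `A`, the nonzero numbers `ε i = κ(e_i, f_i)`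
such that `D⁻¹ A` is symmetric for `D = diag ε`, and the Dynkin labels `wt i = λ_i` of a dominant
integral weight `λ`; the matrix `B` and the Cartan matrix of `𝔤⁻` (the submatrix of `A` for the
indices with `λ_i = 0`) are assumed to be invertible. -/
structure Datum (𝕂 ι : Type*) [Field 𝕂] [Fintype ι] [DecidableEq ι] where
  A : Matrix ι ι ℤ
  diag : ∀ i, A i i = 2
  off_diag : ∀ i j, i ≠ j → A i j ≤ 0
  zero_iff : ∀ i j, A i j = 0 ↔ A j i = 0
  ε : ι → 𝕂
  ε_ne_zero : ∀ i, ε i ≠ 0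
  symm : ∀ i j, (ε i)⁻¹ * (A i j : 𝕂) = (ε j)⁻¹ * (A j i : 𝕂)
  wt : ι → ℕ
  det_A_ne_zero : A.det ≠ 0
  det_B_ne_zero : (extendedMatrix A ε wt).det ≠ 0
  det_AK_ne_zero :
    (A.submatrix (Subtype.val : {i // wt i = 0} → ι) Subtype.val).det ≠ 0

namespace Datum

variable {𝕂 ι : Type*} [Field 𝕂] [Fintype ι] [DecidableEq ι] (T : Datum 𝕂 ι)

/-- The index set `K = {k | λ_k = 0}`; its complement is `J`. -/
abbrev K : Type _ := {i : ι // T.wt i = 0}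

/-- The extended matrix `B` of the data. -/
def B : Matrix (Option ι) (Option ι) 𝕂 := extendedMatrix T.A T.ε T.wt

/-! ### The Kac-Moody algebra `𝔤` -/

/-- The Kac-Moody algebra with Cartan matrix `A`, in its presentation by Chevalley generators and
Serre relations. -/
abbrev 𝔤 : Type _ := T.A.ToLieAlgebra 𝕂

/-- The image in `𝔤` of an element of the free Lie algebra on the Chevalley generators. -/
def mk𝔤 (x : FreeLieAlgebra 𝕂 (CartanMatrix.Generators ι)) : T.𝔤 :=
  (CartanMatrix.Relations.toIdeal 𝕂 T.A).toSubmodule.mkQ x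

/-- The Chevalley generators `e_i` of `𝔤`. -/
def E (i : ι) : T.𝔤 := T.mk𝔤 (FreeLieAlgebra.of 𝕂 (.E i))

/-- The Chevalley generators `f_i` of `𝔤`. -/
def F (i : ι) : T.𝔤 := T.mk𝔤 (FreeLieAlgebra.of 𝕂 (.F i))

/-- The Cartan elements `h_i` of `𝔤`. -/
def H (i : ι) : T.𝔤 := T.mk𝔤 (FreeLieAlgebra.of 𝕂 (.H i))

/-- `κ` is an invariant symmetric bilinear form on `𝔤` with `κ(e_i, f_j) = δ_{ij} ε_j`. -/
structure IsForm (κ : LinearMap.BilinForm 𝕂 T.𝔤) : Prop where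
  symm : ∀ x y, κ x y = κ y x
  invariant : ∀ x y z, κ ⁅x, y⁆ z = κ x ⁅y, z⁆
  apply_E_F : ∀ i j, κ (T.E i) (T.F j) = if i = j then T.ε j else 0

/-- The subalgebra `𝔤⁻` of `𝔤` generated by `e_k, f_k, h_k` for `k ∈ K`. -/
def gMinus : LieSubalgebra 𝕂 T.𝔤 :=
  LieSubalgebra.lieSpan 𝕂 T.𝔤
    {x | ∃ k : T.K, x = T.E k ∨ x = T.F k ∨ x = T.H k}

/-- Weights of `𝔤⁻`, i.e. linear forms `μ` on the Cartan subalgebra of `𝔤⁻` with basis `h_k`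
(`k ∈ K`), given by their values `μ k = μ(h_k)`. -/
abbrev Weight : Type _ := T.K → 𝕂

/-- The simple root `α_k` of `𝔤⁻`: `α_k(h_l) = A_{lk}`. -/
def simpleRoot (k : T.K) : T.Weight := fun l => (T.A l k : 𝕂)

theorem simpleRoot_self (k : T.K) :
    (LinearMap.proj k : Module.Dual 𝕂 T.Weight) (T.simpleRoot k) = 2 := by
  simp [simpleRoot, T.diag]

/-- The fundamental Weyl reflection `μ ↦ μ - μ(h_k) α_k`. -/
def weylReflection (k : T.K) : T.Weight ≃ₗ[𝕂] T.Weight :=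
  Module.reflection (T.simpleRoot_self k)

/-- The Weyl group of `𝔤⁻`. -/
def weylGroup : Subgroup (T.Weight ≃ₗ[𝕂] T.Weight) :=
  Subgroup.closure (Set.range T.weylReflection)

/-- A real root of `𝔤⁻` is a root in the orbit of a simple root under the Weyl group. -/
def IsRealRoot (α : T.Weight) : Prop :=
  ∃ w ∈ T.weylGroup, ∃ k, α = w (T.simpleRoot k)

/-- The root space of `𝔤⁻` for `α`: the elements `x` of `𝔤⁻` with `[h, x] = α(h) x` for all `h` in
the Cartan subalgebra of `𝔤⁻`. -/
def rootSpace (α : T.Weight) : Set T.𝔤 :=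
  {x | x ∈ T.gMinus ∧ ∀ k : T.K, ⁅T.H k, x⁆ = α k • x}

/-- `α_k^∨ = κ(e_k, f_k) α_k`. -/
def simpleCheck (k : T.K) : T.Weight := T.ε k • T.simpleRoot k

/-- The coefficients of a weight of `𝔤⁻` in the basis `α_k^∨` (`k ∈ K`); the rows of the matrix
inverted here are the `α_k^∨`. -/
def coeff (μ : T.Weight) : T.K → 𝕂 := Matrix.vecMul μ (Matrix.of T.simpleCheck)⁻¹

theorem sum_coeff [CharZero 𝕂] (μ : T.Weight) : ∑ k, T.coeff μ k • T.simpleCheck k = μ := by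
  have hdet : IsUnit (Matrix.of T.simpleCheck).det := by
    have h1 : Matrix.of T.simpleCheck = Matrix.diagonal (fun k : T.K => T.ε k) *
        ((T.A.submatrix (Subtype.val : T.K → ι) Subtype.val).map (Int.castRingHom 𝕂)).transpose := by
      ext k l
      simp [simpleCheck, simpleRoot, Matrix.diagonal_mul]
    rw [h1, Matrix.det_mul, Matrix.det_diagonal, Matrix.det_transpose, ← RingHom.mapMatrix_apply,
      ← RingHom.map_det, isUnit_iff_ne_zero]
    refine mul_ne_zero (Finset.prod_ne_zero_iff.2 fun k _ => T.ε_ne_zero k) ?_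
    simpa using T.det_AK_ne_zero
  have h2 := Matrix.vecMul_vecMul μ (Matrix.of T.simpleCheck)⁻¹ (Matrix.of T.simpleCheck)
  rw [Matrix.nonsing_inv_mul _ hdet, Matrix.vecMul_one] at h2
  funext l
  nth_rewrite 2 [← h2]
  simp [coeff, Matrix.vecMul, dotProduct]

/-- `h_{μ^∨} = φ⁻¹(μ)`, where `φ(h)(h') = κ(h, h')`, so that `φ⁻¹(α_k^∨) = h_k`. -/
def hCheck (μ : T.Weight) : T.𝔤 := ∑ k : T.K, T.coeff μ k • T.H k

/-- The form `(μ, ν) = κ(φ⁻¹(μ), φ⁻¹(ν))` on the weights of `𝔤⁻`. -/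
def pairing (κ : LinearMap.BilinForm 𝕂 T.𝔤) (μ ν : T.Weight) : 𝕂 := κ (T.hCheck μ) (T.hCheck ν)

/-! ### The tensor hierarchy algebra `W` -/

/-- The generators of `W`: `e_i` and `h_i` for `i ∈ {0} ∪ I`, `f_i` for `i ∈ I`, and `f_{0i}` for
`i ∈ {0} ∪ K`. -/
inductive Gen (T : Datum 𝕂 ι) : Type _
  | e : Option ι → Gen T
  | h : Option ι → Gen T
  | f : ι → Gen T
  | f0 : Option T.K → Gen T

/-- The consistent grading: `e_0` has degree `1`, the `f_{0i}` have degree `-1`, all other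
generators have degree `0`. -/
def genDeg : Gen T → ℤ
  | .e none => 1
  | .f0 _ => -1
  | _ => 0

/-- The free non-associative algebra on the generators of `W`. -/
abbrev Lib : Type _ := FreeNonUnitalNonAssocAlgebra 𝕂 (Gen T)

/-- A generator of `W`, in the free algebra. -/
abbrev gen (x : Gen T) : T.Lib := FreeNonUnitalNonAssocAlgebra.of 𝕂 x

open Gen in
/-- The defining relations of `W̃`; the product stands for the bracket. The Serre relation for
`i, j` has the exponent `1 - B_{ij} = n + 1`, and is imposed when this is a positive integer. -/
inductive Rel : T.Lib → T.Lib → Prop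
  | e_f (i : Option ι) (j : ι) : Rel (T.gen (e i) * T.gen (f j))
      (if i = some j then T.gen (h (some j)) else 0)
  | h_f (i : Option ι) (j : ι) : Rel (T.gen (h i) * T.gen (f j))
      (-(T.B i (some j) • T.gen (f j)))
  | h_e (i j : Option ι) : Rel (T.gen (h i) * T.gen (e j)) (T.B i j • T.gen (e j))
  | e0_f0 (i : Option T.K) : Rel (T.gen (e none) * T.gen (f0 i))
      (T.gen (h (i.map Subtype.val)))
  | h_f0 (i : Option ι) (j : Option T.K) : Rel (T.gen (h i) * T.gen (f0 j))
      (-(T.B i none • T.gen (f0 j)))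
  | serre_e (i j : Option ι) (n : ℕ) : T.B i j = -(n : 𝕂) →
      Rel ((T.gen (e i) * ·)^[n + 1] (T.gen (e j))) 0
  | serre_f (i j : ι) (n : ℕ) : T.B (some i) (some j) = -(n : 𝕂) →
      Rel ((T.gen (f i) * ·)^[n + 1] (T.gen (f j))) 0
  | e_f_f0 (k l : T.K) (i : Option T.K) :
      Rel (T.gen (e (some k)) * (T.gen (f l) * T.gen (f0 i)))
        (if k = l then T.B (i.map Subtype.val) (some l) • T.gen (f0 (some k)) else 0)
  | fJ_f0 (j : ι) (i : Option T.K) : T.wt j ≠ 0 →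
      Rel ((T.gen (f j) * ·)^[T.wt j + 1] (T.gen (f0 i))) 0
  | eJ_f0 (j : ι) (i : Option T.K) : T.wt j ≠ 0 → Rel (T.gen (e (some j)) * T.gen (f0 i)) 0
  | e_e_f0 (k : T.K) (i : Option T.K) :
      Rel (T.gen (e (some k)) * (T.gen (e (some k)) * T.gen (f0 i))) 0
  | f_f_f0 (k : T.K) (i : Option T.K) :
      Rel (T.gen (f k) * (T.gen (f k) * T.gen (f0 i))) 0
  | eJ_e_f0 (j : ι) (k : T.K) (i : Option T.K) : T.wt j ≠ 0 →
      Rel (T.gen (e (some j)) * (T.gen (e (some k)) * T.gen (f0 i))) 0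

/-- The auxiliary Lie superalgebra `W̃`. -/
def tildeW : SuperLie 𝕂 (T.Lib ⧸ presIdeal T.genDeg T.Rel) := presented T.genDeg T.Rel

/-- The underlying space of the tensor hierarchy algebra `W`, the quotient of `W̃` by its maximal
graded ideal which intersects the local part trivially. -/
def W : Type _ := (T.Lib ⧸ presIdeal T.genDeg T.Rel) ⧸ T.tildeW.maxIdeal

instance : AddCommGroup T.W :=
  inferInstanceAs (AddCommGroup ((T.Lib ⧸ presIdeal T.genDeg T.Rel) ⧸ T.tildeW.maxIdeal))

instance : Module 𝕂 T.W :=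
  inferInstanceAs (Module 𝕂 ((T.Lib ⧸ presIdeal T.genDeg T.Rel) ⧸ T.tildeW.maxIdeal))

/-- The Lie superalgebra structure of `W`. -/
def superW : SuperLie 𝕂 T.W := T.tildeW.minimal

instance : Bracket T.W T.W := ⟨fun x y => T.superW.bracket x y⟩

theorem lie_def (x y : T.W) : ⁅x, y⁆ = T.superW.bracket x y := rfl

/-- The quotient map from the free algebra to `W`. -/
def toW : T.Lib →ₗ[𝕂] T.W :=
  T.tildeW.maxIdeal.mkQ ∘ₗ (presIdeal T.genDeg T.Rel).mkQ

theorem toW_mul (x y : T.Lib) : T.toW (x * y) = ⁅T.toW x, T.toW y⁆ := rfl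

theorem toW_rel {x y : T.Lib} (h : T.Rel x y) : T.toW x = T.toW y :=
  congrArg T.tildeW.maxIdeal.mkQ (mk_eq_of_rel (PresRel.rel (d := T.genDeg) h))

theorem toW_gen_mem (x : Gen T) {n : ℤ} (h : T.genDeg x = n) :
    T.toW (T.gen x) ∈ T.superW.piece n :=
  ⟨_, ⟨_, Submodule.subset_span ⟨FreeMagma.of x, h, rfl⟩, rfl⟩, rfl⟩

theorem toW_iterate (a x : T.Lib) (n : ℕ) :
    T.toW ((a * ·)^[n] x) = (fun z => ⁅T.toW a, z⁆)^[n] (T.toW x) := by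
  induction n with
  | zero => rfl
  | succ n ih => rw [Function.iterate_succ_apply', Function.iterate_succ_apply', toW_mul, ih]

/-- The element `f_{0μ^∨}` of `W`: the linear combination of the `f_{0k}` (`k ∈ K`) with the same
coefficients as `μ` has in the basis `α_k^∨`. -/
def f0Check (μ : T.Weight) : T.W := ∑ k : T.K, T.coeff μ k • T.toW (T.gen (.f0 (some k)))

section Inclusion

variable [CharZero 𝕂]

/-- The Chevalley generators in the degree `0` subalgebra of `W`. -/
def genZero : CartanMatrix.Generators ι → T.superW.piece 0
  | .H i => ⟨T.toW (T.gen (.h (some i))), T.toW_gen_mem _ rfl⟩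
  | .E i => ⟨T.toW (T.gen (.e (some i))), T.toW_gen_mem _ rfl⟩
  | .F i => ⟨T.toW (T.gen (.f i)), T.toW_gen_mem _ rfl⟩

theorem coe_iterate_ad (a x : T.superW.piece 0) (n : ℕ) :
    (((LieAlgebra.ad 𝕂 (T.superW.piece 0) a ^ n) x : T.superW.piece 0) : T.W) =
      (fun z : T.W => ⁅(a : T.W), z⁆)^[n] (x : T.W) := by
  induction n with
  | zero => rfl
  | succ n ih =>
    rw [Function.iterate_succ_apply', ← ih, pow_succ']
    rfl

theorem genZero_EF (i j : ι) : ⁅T.genZero (.E i), T.genZero (.F j)⁆ =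
    if i = j then T.genZero (.H i) else 0 := by
  ext
  have h := T.toW_rel (Rel.e_f (T := T) (some i) j)
  rw [toW_mul] at h
  refine Eq.trans h ?_
  by_cases hij : i = j
  · subst hij; simp [genZero]
  · simp [hij]

theorem genZero_HE (i j : ι) : ⁅T.genZero (.H i), T.genZero (.E j)⁆ =
    (T.A i j : ℤ) • T.genZero (.E j) := by
  ext
  have h := T.toW_rel (Rel.h_e (T := T) (some i) (some j))
  rw [toW_mul] at h
  refine Eq.trans h ?_
  simp [genZero, B, extendedMatrix, Int.cast_smul_eq_zsmul]

theorem genZero_HF (i j : ι) : ⁅T.genZero (.H i), T.genZero (.F j)⁆ =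
    -((T.A i j : ℤ) • T.genZero (.F j)) := by
  ext
  have h := T.toW_rel (Rel.h_f (T := T) (some i) j)
  rw [toW_mul] at h
  refine Eq.trans h ?_
  simp [genZero, B, extendedMatrix, Int.cast_smul_eq_zsmul]

theorem genZero_HH (i j : ι) : ⁅T.genZero (.H i), T.genZero (.H j)⁆ = 0 := by
  have h : T.genZero (.H j) = ⁅T.genZero (.E j), T.genZero (.F j)⁆ := by simp [genZero_EF]
  rw [h, leibniz_lie, genZero_HE, genZero_HF]
  simp

theorem genZero_adE (i j : ι) : (LieAlgebra.ad 𝕂 (T.superW.piece 0) (T.genZero (.E i)) ^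
    (-T.A i j).toNat) ⁅T.genZero (.E i), T.genZero (.E j)⁆ = 0 := by
  by_cases hij : i = j
  · subst hij; simp
  ext
  have hn : T.B (some i) (some j) = -(((-T.A i j).toNat : ℕ) : 𝕂) := by
    have h0 : (((-T.A i j).toNat : ℕ) : ℤ) = -T.A i j :=
      Int.toNat_of_nonneg (by have := T.off_diag i j hij; omega)
    have h1 : (((-T.A i j).toNat : ℕ) : 𝕂) = ((-T.A i j : ℤ) : 𝕂) := by
      rw [← h0, Int.cast_natCast, h0]
    rw [h1]; simp [B, extendedMatrix]
  have h := T.toW_rel (Rel.serre_e (some i) (some j) _ hn)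
  rw [toW_iterate, Function.iterate_succ_apply, map_zero] at h
  rw [coe_iterate_ad]
  exact h

theorem genZero_adF (i j : ι) : (LieAlgebra.ad 𝕂 (T.superW.piece 0) (T.genZero (.F i)) ^
    (-T.A i j).toNat) ⁅T.genZero (.F i), T.genZero (.F j)⁆ = 0 := by
  by_cases hij : i = j
  · subst hij; simp
  ext
  have hn : T.B (some i) (some j) = -(((-T.A i j).toNat : ℕ) : 𝕂) := by
    have h0 : (((-T.A i j).toNat : ℕ) : ℤ) = -T.A i j :=
      Int.toNat_of_nonneg (by have := T.off_diag i j hij; omega)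
    have h1 : (((-T.A i j).toNat : ℕ) : 𝕂) = ((-T.A i j : ℤ) : 𝕂) := by
      rw [← h0, Int.cast_natCast, h0]
    rw [h1]; simp [B, extendedMatrix]
  have h := T.toW_rel (Rel.serre_f i j _ hn)
  rw [toW_iterate, Function.iterate_succ_apply, map_zero] at h
  rw [coe_iterate_ad]
  exact h

/-- The homomorphism from the free Lie algebra on the Chevalley generators to `W`. -/
def freeToW : FreeLieAlgebra 𝕂 (CartanMatrix.Generators ι) →ₗ⁅𝕂⁆ T.superW.piece 0 :=
  FreeLieAlgebra.lift 𝕂 T.genZero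

theorem freeToW_ad (a x : FreeLieAlgebra 𝕂 (CartanMatrix.Generators ι)) (n : ℕ) :
    T.freeToW ((LieAlgebra.ad 𝕂 _ a ^ n) x) =
      (LieAlgebra.ad 𝕂 (T.superW.piece 0) (T.freeToW a) ^ n) (T.freeToW x) := by
  induction n with
  | zero => rfl
  | succ n ih => simp only [pow_succ', Module.End.mul_apply, LieAlgebra.ad_apply, LieHom.map_lie, ih]

theorem toIdeal_le_ker : CartanMatrix.Relations.toIdeal 𝕂 T.A ≤ T.freeToW.ker := by
  refine LieSubmodule.lieSpan_le.2 ?_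
  have hof : ∀ x, T.freeToW (FreeLieAlgebra.of 𝕂 x) = T.genZero x := fun x => by
    simp [freeToW]
  rintro _ (((((⟨⟨i, j⟩, rfl⟩ | ⟨⟨i, j⟩, rfl⟩) | ⟨⟨i, j⟩, rfl⟩) | ⟨⟨i, j⟩, rfl⟩) | ⟨⟨i, j⟩, rfl⟩) |
    ⟨⟨i, j⟩, rfl⟩) <;> rw [SetLike.mem_coe, LieHom.mem_ker]
  · simp [CartanMatrix.Relations.HH, hof, genZero_HH]
  · by_cases hij : i = j
    · subst hij; simp [CartanMatrix.Relations.EF, hof, genZero_EF]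
    · simp [CartanMatrix.Relations.EF, hof, genZero_EF, hij]
  · simp [CartanMatrix.Relations.HE, hof, genZero_HE]
  · simp [CartanMatrix.Relations.HF, hof, genZero_HF]
  · simp [CartanMatrix.Relations.adE, hof, freeToW_ad, genZero_adE]
  · simp [CartanMatrix.Relations.adF, hof, freeToW_ad, genZero_adF]

/-- The homomorphism from `𝔤` to `W` which maps the generators `e_i, f_i, h_i` of `𝔤` to the
generators `e_i, f_i, h_i` of `W`. -/
def toWZero : T.𝔤 →ₗ⁅𝕂⁆ T.superW.piece 0 :=
  { (CartanMatrix.Relations.toIdeal 𝕂 T.A).toSubmodule.liftQ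
      (T.freeToW : FreeLieAlgebra 𝕂 (CartanMatrix.Generators ι) →ₗ[𝕂] T.superW.piece 0)
      (fun _ hx => T.toIdeal_le_ker hx) with
    map_lie' := by
      intro x y
      obtain ⟨x, rfl⟩ := Submodule.mkQ_surjective _ x
      obtain ⟨y, rfl⟩ := Submodule.mkQ_surjective _ y
      exact LieHom.map_lie T.freeToW x y }

/-- An element of `𝔤`, regarded as an element of `W`. -/
def incl : T.𝔤 →ₗ[𝕂] T.W := (T.superW.piece 0).subtype ∘ₗ (T.toWZero : T.𝔤 →ₗ[𝕂] _)

theorem incl_lie (x y : T.𝔤) : T.incl ⁅x, y⁆ = ⁅T.incl x, T.incl y⁆ := by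
  simp only [incl, LinearMap.comp_apply, LieHom.coe_toLinearMap, LieHom.map_lie]
  rfl

theorem incl_E (i : ι) : T.incl (T.E i) = T.toW (T.gen (.e (some i))) :=
  congrArg Subtype.val (FreeLieAlgebra.lift_of_apply T.genZero (.E i))

theorem incl_F (i : ι) : T.incl (T.F i) = T.toW (T.gen (.f i)) :=
  congrArg Subtype.val (FreeLieAlgebra.lift_of_apply T.genZero (.F i))

theorem incl_H (i : ι) : T.incl (T.H i) = T.toW (T.gen (.h (some i))) :=
  congrArg Subtype.val (FreeLieAlgebra.lift_of_apply T.genZero (.H i))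

end Inclusion

end Datum

end THA

end

/-! For a simple root the identities are nearly the defining relations of $W$; for a general real
root they are transported by the Weyl group, realised by the operators
$r_k=\exp(e_k)\exp(-f_k)\exp(e_k)$ acting on $\mathfrak g$ and on a $\mathfrak g$-module at the same
time.

The relations of $W$ say that $e_k,f_k$ act on the $f_{0i}$ ($k,i\in K$) by the formulas that hold
for the $h_i$ in the adjoint module: $e_ke_k$ and $f_kf_k$ give $0$, while $e_kf_k$ and $f_ke_k$
both send $f_{0i}$ to $A_{ik}f_{0k}$. `IsCartanFamily` axiomatises this. A short $\mathfrak{sl}_2$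
argument (`two_smul_lie_of_string`) shows that $2v_i-A_{ik}v_k$ is killed by $e_k$ and $f_k$. This
gives the third identity for simple roots, and it also gives $r_kv_i=v_i-A_{ik}v_k$
(`weylOp_apply_of_string`). Hence $r_k$ sends the combination attached to a weight $\mu$ to the one
attached to $s_k\mu$ (`moduleReflection_comb`), both for the $h_i$ and for the $f_{0i}$.

Since exponentials of derivations respect bilinear maps (`locExp_bilin`), $r_k$ preserves brackets
and $\kappa$, permutes the root spaces of $\mathfrak g^-$ as $s_k$ does, and leaves the pairing of
weights invariant. As $r_k$ is injective, the identities for $\alpha$ imply those for $s_k\alpha$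
(`RootIdentities.weylReflection`).

Two further points are needed. The root spaces of $\pm\alpha_k$ are spanned by $e_k$ and $f_k$
(`ChevalleyRelations.mem_span_of_simpleRoot`). The exponentials must make sense: $\mathfrak g$ is
integrable by the Serre relations, and in $W$ it suffices to work in the submodule of vectors on
which all $e_k,f_k$ ($k\in K$) are nilpotent, which contains the $f_{0k}$. -/

noncomputable section

namespace THA

/-! ### Exponentials of locally nilpotent endomorphisms -/

section LocallyNilpotent

variable {𝕂 M M₁ M₂ M₃ : Type*} [Field 𝕂] [AddCommGroup M] [Module 𝕂 M]
  [AddCommGroup M₁] [Module 𝕂 M₁] [AddCommGroup M₂] [Module 𝕂 M₂] [AddCommGroup M₃] [Module 𝕂 M₃]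

/-- Every vector is annihilated by some power of `φ`. -/
def IsLocallyNilpotent (φ : Module.End 𝕂 M) : Prop := ∀ m, ∃ n : ℕ, (φ ^ n) m = 0

theorem pow_apply_eq_zero_of_le {φ : Module.End 𝕂 M} {m : M} {n k : ℕ} (hnk : n ≤ k)
    (h : (φ ^ n) m = 0) : (φ ^ k) m = 0 := by
  obtain ⟨j, rfl⟩ := Nat.exists_eq_add_of_le' hnk
  rw [pow_add, Module.End.mul_apply, h, map_zero]

theorem IsLocallyNilpotent.neg {φ : Module.End 𝕂 M} (h : IsLocallyNilpotent φ) :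
    IsLocallyNilpotent (-φ) := fun m => by
  obtain ⟨n, hn⟩ := h m
  refine ⟨n, ?_⟩
  rcases Nat.even_or_odd n with h | h
  · rw [h.neg_pow, hn]
  · rw [h.neg_pow, LinearMap.neg_apply, hn, neg_zero]

theorem isLocallyNilpotent_zero : IsLocallyNilpotent (0 : Module.End 𝕂 M) :=
  fun _ => ⟨1, by simp⟩

/-- The sum of the first `n` terms of the exponential series of `φ`, applied to `m`. -/
def expSum (φ : Module.End 𝕂 M) (n : ℕ) (m : M) : M :=
  ∑ i ∈ Finset.range n, (i.factorial : 𝕂)⁻¹ • (φ ^ i) m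

/-- Any sufficiently late truncation gives the exponential, so different vectors can be compared at
a common truncation. -/
theorem expSum_eq_of_le {φ : Module.End 𝕂 M} {m : M} {n k : ℕ} (hnk : n ≤ k)
    (h : (φ ^ n) m = 0) : expSum φ k m = expSum φ n m := by
  refine (Finset.sum_subset (Finset.range_mono hnk) fun i _ hi => ?_).symm
  rw [pow_apply_eq_zero_of_le (by simpa using hi) h, smul_zero]

open scoped Classical in
/-- The exponential of a locally nilpotent endomorphism. -/
def locExp (φ : Module.End 𝕂 M) (hφ : IsLocallyNilpotent φ) : M →ₗ[𝕂] M where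
  toFun m := expSum φ (Nat.find (hφ m)) m
  map_add' x y := by
    have hx := Nat.find_spec (hφ x)
    have hy := Nat.find_spec (hφ y)
    have hxy := Nat.find_spec (hφ (x + y))
    set a := Nat.find (hφ x)
    set b := Nat.find (hφ y)
    set c := Nat.find (hφ (x + y))
    rw [← expSum_eq_of_le (show a ≤ a + b + c by omega) hx,
      ← expSum_eq_of_le (show b ≤ a + b + c by omega) hy,
      ← expSum_eq_of_le (show c ≤ a + b + c by omega) hxy]
    simp [expSum, Finset.sum_add_distrib]
  map_smul' t x := by
    have hx := Nat.find_spec (hφ x)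
    have hy := Nat.find_spec (hφ (t • x))
    set a := Nat.find (hφ x)
    set b := Nat.find (hφ (t • x))
    rw [RingHom.id_apply, ← expSum_eq_of_le (show a ≤ a + b by omega) hx,
      ← expSum_eq_of_le (show b ≤ a + b by omega) hy]
    simp only [expSum, map_smul, Finset.smul_sum]
    exact Finset.sum_congr rfl fun i _ => smul_comm _ _ _

variable {φ : Module.End 𝕂 M} (hφ : IsLocallyNilpotent φ)

theorem locExp_apply {m : M} {n : ℕ} (h : (φ ^ n) m = 0) : locExp φ hφ m = expSum φ n m := by
  classical
  have h' := Nat.find_spec (hφ m)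
  change expSum φ (Nat.find (hφ m)) m = _
  set a := Nat.find (hφ m)
  rw [← expSum_eq_of_le (show a ≤ a + n by omega) h',
    ← expSum_eq_of_le (show n ≤ a + n by omega) h]

theorem locExp_apply_of_one {m : M} (h : φ m = 0) : locExp φ hφ m = m := by
  rw [locExp_apply hφ (n := 1) (by simpa using h)]
  simp [expSum]

theorem locExp_apply_of_two {m : M} (h : φ (φ m) = 0) : locExp φ hφ m = m + φ m := by
  rw [locExp_apply hφ (n := 2) (by simpa [pow_succ] using h)]
  simp [expSum, Finset.sum_range_succ]

theorem locExp_apply_of_three {m : M} (h : φ (φ (φ m)) = 0) :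
    locExp φ hφ m = m + φ m + (2 : 𝕂)⁻¹ • φ (φ m) := by
  rw [locExp_apply hφ (n := 3) (by simpa [pow_succ] using h)]
  simp [expSum, Finset.sum_range_succ, pow_succ]

theorem locExp_injective : Function.Injective (locExp φ hφ) := by
  rw [injective_iff_map_eq_zero]
  intro m hm
  obtain ⟨n, hn⟩ := hφ m
  induction n with
  | zero => simpa using hn
  | succ n ih =>
    refine ih ?_
    -- As $\varphi^{n+1}m=0$, applying $\varphi^n$ to $\exp(\varphi)m=0$ leaves only the constant
    -- term, so $\varphi^nm=0$ and the exponent drops by one.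
    have h := congrArg (φ ^ n) hm
    rw [locExp_apply hφ hn, expSum, map_zero, map_sum, Finset.sum_range_succ',
      Finset.sum_eq_zero fun i _ => ?_] at h
    · simpa using h
    · rw [map_smul, ← Module.End.mul_apply, ← pow_add,
        pow_apply_eq_zero_of_le (by omega : n + 1 ≤ n + (i + 1)) hn, smul_zero]

variable {φ₁ : Module.End 𝕂 M₁} {φ₂ : Module.End 𝕂 M₂} {φ₃ : Module.End 𝕂 M₃}
  {b : M₁ →ₗ[𝕂] M₂ →ₗ[𝕂] M₃}

/-- Leibniz rule for powers: `b` factors through the tensor product, where $\varphi_1\otimes1$ and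
$1\otimes\varphi_2$ commute, so the binomial theorem applies to their sum. -/
theorem pow_apply_bilin (h : ∀ u v, φ₃ (b u v) = b (φ₁ u) v + b u (φ₂ v)) (n : ℕ) (u : M₁)
    (v : M₂) : (φ₃ ^ n) (b u v) =
      ∑ p ∈ Finset.HasAntidiagonal.antidiagonal n, n.choose p.1 • b ((φ₁ ^ p.1) u) ((φ₂ ^ p.2) v) := by
  have hc : Commute (φ₁.rTensor M₂) (φ₂.lTensor M₁) := by
    apply TensorProduct.ext'
    intro x y
    simp
  have hl : ∀ (n : ℕ) (t : TensorProduct 𝕂 M₁ M₂), (φ₃ ^ n) (TensorProduct.lift b t) =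
      TensorProduct.lift b (((φ₁.rTensor M₂ + φ₂.lTensor M₁) ^ n) t) := by
    intro n
    induction n with
    | zero => intro t; simp
    | succ n ih =>
      intro t
      rw [pow_succ, pow_succ, Module.End.mul_apply, Module.End.mul_apply, ← ih]
      congr 1
      induction t with
      | zero => simp
      | add x y hx hy => simp only [map_add, hx, hy]
      | tmul x y => simp [h]
  have := hl n (TensorProduct.tmul 𝕂 u v)
  rw [TensorProduct.lift.tmul] at this
  rw [this, hc.add_pow', LinearMap.sum_apply, map_sum]
  refine Finset.sum_congr rfl fun p _ => ?_
  rw [LinearMap.smul_apply, map_nsmul, Module.End.mul_apply, LinearMap.lTensor_pow,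
    LinearMap.rTensor_pow]
  simp

theorem pow_apply_bilin_eq_zero (h : ∀ u v, φ₃ (b u v) = b (φ₁ u) v + b u (φ₂ v)) {n k : ℕ}
    {u : M₁} {v : M₂} (hu : (φ₁ ^ n) u = 0) (hv : (φ₂ ^ k) v = 0) :
    (φ₃ ^ (n + k)) (b u v) = 0 := by
  rw [pow_apply_bilin h]
  refine Finset.sum_eq_zero fun p hp => ?_
  rw [Finset.HasAntidiagonal.mem_antidiagonal] at hp
  rcases le_or_gt n p.1 with h1 | h1
  · rw [pow_apply_eq_zero_of_le h1 hu]; simp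
  · rw [pow_apply_eq_zero_of_le (by omega : k ≤ p.2) hv]; simp

/-- The identity $\exp(\varphi_3)\,b(u,v)=b(\exp(\varphi_1)u,\exp(\varphi_2)v)$ is kept general in
three modules because it serves for a module action, for the adjoint action and for $\kappa$. -/
theorem locExp_bilin [CharZero 𝕂] (h : ∀ u v, φ₃ (b u v) = b (φ₁ u) v + b u (φ₂ v))
    (h₁ : IsLocallyNilpotent φ₁) (h₂ : IsLocallyNilpotent φ₂) (h₃ : IsLocallyNilpotent φ₃)
    (u : M₁) (v : M₂) :
    locExp φ₃ h₃ (b u v) = b (locExp φ₁ h₁ u) (locExp φ₂ h₂ v) := by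
  obtain ⟨n, hn⟩ := h₁ u
  obtain ⟨k, hk⟩ := h₂ v
  rw [locExp_apply h₃ (pow_apply_bilin_eq_zero h hn hk), locExp_apply h₁ hn, locExp_apply h₂ hk]
  set g : ℕ × ℕ → M₃ := fun p =>
    ((p.1.factorial : 𝕂)⁻¹ * (p.2.factorial : 𝕂)⁻¹) • b ((φ₁ ^ p.1) u) ((φ₂ ^ p.2) v) with hg
  -- The left side sums `g` over the triangle $p_1+p_2<n+k$, cut into antidiagonals; the right side
  -- sums it over the rectangle $p_1<n$, $p_2<k$. The rectangle lies in the triangle and `g`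
  -- vanishes outside it.
  have hl : expSum φ₃ (n + k) (b u v) =
      ∑ p ∈ (Finset.range (n + k)).biUnion Finset.HasAntidiagonal.antidiagonal, g p := by
    rw [Finset.sum_biUnion]
    · refine Finset.sum_congr rfl fun i _ => ?_
      rw [pow_apply_bilin h, Finset.smul_sum]
      refine Finset.sum_congr rfl fun p hp => ?_
      rw [Finset.HasAntidiagonal.mem_antidiagonal] at hp
      subst hp
      rw [← Nat.cast_smul_eq_nsmul 𝕂, smul_smul, Nat.cast_add_choose]
      simp only [hg]
      congr 1
      have := Nat.cast_ne_zero (R := 𝕂).2 (p.1 + p.2).factorial_ne_zero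
      field_simp
    · intro i _ j _ hij
      exact Finset.disjoint_left.2 fun p hp hq => hij (by
        rw [Finset.HasAntidiagonal.mem_antidiagonal] at hp hq; omega)
  have hr : b (expSum φ₁ n u) (expSum φ₂ k v) =
      ∑ p ∈ Finset.range n ×ˢ Finset.range k, g p := by
    rw [Finset.sum_product, expSum, map_sum, LinearMap.sum_apply]
    refine Finset.sum_congr rfl fun i _ => ?_
    rw [expSum, map_sum]
    refine Finset.sum_congr rfl fun j _ => ?_
    simp only [hg, map_smul, LinearMap.smul_apply, smul_smul, mul_comm]
  rw [hl, hr]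
  refine (Finset.sum_subset ?_ ?_).symm
  · intro p hp
    simp only [Finset.mem_product, Finset.mem_range, Finset.mem_biUnion,
      Finset.HasAntidiagonal.mem_antidiagonal] at hp ⊢
    exact ⟨p.1 + p.2, by omega, rfl⟩
  · intro p _ hp
    simp only [Finset.mem_product, Finset.mem_range, not_and_or, not_lt] at hp
    rcases hp with h1 | h1
    · simp [hg, pow_apply_eq_zero_of_le h1 hn]
    · simp [hg, pow_apply_eq_zero_of_le h1 hk]

end LocallyNilpotent

/-! ### The Weyl group operator of an `sl₂`-triple -/

section Weyl

variable {𝕂 L M : Type*} [Field 𝕂] [LieRing L] [LieAlgebra 𝕂 L]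
  [AddCommGroup M] [Module 𝕂 M] [LieRingModule L M] [LieModule 𝕂 L M]

/-- The operator `exp e exp (-f) exp e`. -/
def weylOp (φ ψ : Module.End 𝕂 M) (hφ : IsLocallyNilpotent φ) (hψ : IsLocallyNilpotent ψ) :
    M →ₗ[𝕂] M :=
  locExp φ hφ ∘ₗ locExp (-ψ) hψ.neg ∘ₗ locExp φ hφ

theorem weylOp_injective {φ ψ : Module.End 𝕂 M} (hφ : IsLocallyNilpotent φ)
    (hψ : IsLocallyNilpotent ψ) : Function.Injective (weylOp φ ψ hφ hψ) :=
  (locExp_injective hφ).comp ((locExp_injective hψ.neg).comp (locExp_injective hφ))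

theorem weylOp_bilin [CharZero 𝕂] {M₁ M₂ M₃ : Type*} [AddCommGroup M₁] [Module 𝕂 M₁]
    [AddCommGroup M₂] [Module 𝕂 M₂] [AddCommGroup M₃] [Module 𝕂 M₃]
    {φ₁ ψ₁ : Module.End 𝕂 M₁} {φ₂ ψ₂ : Module.End 𝕂 M₂} {φ₃ ψ₃ : Module.End 𝕂 M₃}
    {b : M₁ →ₗ[𝕂] M₂ →ₗ[𝕂] M₃} (hφ : ∀ u v, φ₃ (b u v) = b (φ₁ u) v + b u (φ₂ v))
    (hψ : ∀ u v, ψ₃ (b u v) = b (ψ₁ u) v + b u (ψ₂ v))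
    (h₁ : IsLocallyNilpotent φ₁) (h₁' : IsLocallyNilpotent ψ₁) (h₂ : IsLocallyNilpotent φ₂)
    (h₂' : IsLocallyNilpotent ψ₂) (h₃ : IsLocallyNilpotent φ₃) (h₃' : IsLocallyNilpotent ψ₃)
    (u : M₁) (v : M₂) :
    weylOp φ₃ ψ₃ h₃ h₃' (b u v) = b (weylOp φ₁ ψ₁ h₁ h₁' u) (weylOp φ₂ ψ₂ h₂ h₂' v) := by
  have hψ' : ∀ u v, (-ψ₃) (b u v) = b ((-ψ₁) u) v + b u ((-ψ₂) v) := fun u v => by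
    simp only [LinearMap.neg_apply, hψ, map_neg, neg_add]
  simp only [weylOp, LinearMap.comp_apply]
  rw [locExp_bilin hφ h₁ h₂, locExp_bilin hψ' h₁'.neg h₂'.neg, locExp_bilin hφ h₁ h₂]

variable {e f : L} {u m : M} {c : 𝕂}

/-- The vector $y=2m-cu$ satisfies $fey=efy=eey=0$. Each term in the expansion of $[[e,f],e]y$
contains one of these, and $[[e,f],e]=2e$, so $ey=0$. -/
theorem two_smul_lie_of_string [CharZero 𝕂] (he : ⁅⁅e, f⁆, e⁆ = (2 : 𝕂) • e)
    (heu : ⁅e, ⁅e, u⁆⁆ = 0) (hefu : ⁅e, ⁅f, u⁆⁆ = (2 : 𝕂) • u) (hfeu : ⁅f, ⁅e, u⁆⁆ = (2 : 𝕂) • u)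
    (hem : ⁅e, ⁅e, m⁆⁆ = 0) (hefm : ⁅e, ⁅f, m⁆⁆ = c • u) (hfem : ⁅f, ⁅e, m⁆⁆ = c • u) :
    (2 : 𝕂) • ⁅e, m⁆ = c • ⁅e, u⁆ := by
  rw [← sub_eq_zero]
  set y := (2 : 𝕂) • m - c • u with hy
  have hey : ⁅e, y⁆ = (2 : 𝕂) • ⁅e, m⁆ - c • ⁅e, u⁆ := by simp [hy]
  rw [← hey]
  have h1 : ⁅f, ⁅e, y⁆⁆ = 0 := by
    rw [hey, lie_sub, lie_smul, lie_smul, hfem, hfeu]; module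
  have h2 : ⁅e, ⁅e, y⁆⁆ = 0 := by
    rw [hey, lie_sub, lie_smul, lie_smul, hem, heu]; simp
  have h3 : ⁅e, ⁅f, y⁆⁆ = 0 := by
    rw [hy, lie_sub, lie_smul, lie_smul, lie_sub, lie_smul, lie_smul, hefm, hefu]; module
  have h4 : ⁅⁅⁅e, f⁆, e⁆, y⁆ = 0 := by
    rw [lie_lie ⁅e, f⁆ e y, lie_lie e f ⁅e, y⁆, lie_lie e f y, h1, h2, h3]
    simp
  rw [he, smul_lie] at h4
  exact (smul_eq_zero.1 h4).resolve_left two_ne_zero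

/-- Write $2m=y+cu$ with $y=2m-cu$. By `two_smul_lie_of_string`, used also with $e$ and $f$
exchanged, $y$ is killed by both and hence fixed, while $u$ behaves like the coroot of
$\mathfrak{sl}_2$ and changes sign. -/
theorem weylOp_apply_of_string [CharZero 𝕂] (he : ⁅⁅e, f⁆, e⁆ = (2 : 𝕂) • e)
    (hf : ⁅⁅f, e⁆, f⁆ = (2 : 𝕂) • f)
    (heu : ⁅e, ⁅e, u⁆⁆ = 0) (hfu : ⁅f, ⁅f, u⁆⁆ = 0) (hefu : ⁅e, ⁅f, u⁆⁆ = (2 : 𝕂) • u)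
    (hfeu : ⁅f, ⁅e, u⁆⁆ = (2 : 𝕂) • u)
    (hem : ⁅e, ⁅e, m⁆⁆ = 0) (hfm : ⁅f, ⁅f, m⁆⁆ = 0) (hefm : ⁅e, ⁅f, m⁆⁆ = c • u)
    (hfem : ⁅f, ⁅e, m⁆⁆ = c • u)
    (h₁ : IsLocallyNilpotent (LieModule.toEnd 𝕂 L M e))
    (h₂ : IsLocallyNilpotent (LieModule.toEnd 𝕂 L M f)) :
    weylOp (LieModule.toEnd 𝕂 L M e) (LieModule.toEnd 𝕂 L M f) h₁ h₂ m = m - c • u := by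
  set r := weylOp (LieModule.toEnd 𝕂 L M e) (LieModule.toEnd 𝕂 L M f) h₁ h₂ with hr
  have hru : r u = -u := by
    -- The three exponentials take $u\mapsto u+eu\mapsto -u+eu\mapsto -u$.
    have s1 : locExp _ h₁ u = u + ⁅e, u⁆ := locExp_apply_of_two h₁ heu
    have s2 : locExp _ h₂.neg (u + ⁅e, u⁆) = -u + ⁅e, u⁆ := by
      have hff : ⁅f, ⁅f, u + ⁅e, u⁆⁆⁆ = (2 : 𝕂) • ⁅f, u⁆ := by
        rw [lie_add, lie_add, hfu, hfeu, lie_smul, zero_add]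
      rw [locExp_apply_of_three]
      · simp only [LinearMap.neg_apply, LieModule.toEnd_apply_apply, map_neg, neg_neg, hff,
          smul_smul]
        rw [lie_add, hfeu]
        norm_num
        module
      · simp only [LinearMap.neg_apply, LieModule.toEnd_apply_apply, map_neg, neg_neg, hff,
          lie_smul, hfu, smul_zero, neg_zero]
    have s3 : locExp _ h₁ (-u + ⁅e, u⁆) = -u := by
      rw [locExp_apply_of_two]
      · simp [heu]
      · simp [heu]
    rw [hr, weylOp, LinearMap.comp_apply, LinearMap.comp_apply, s1, s2, s3]
  set y := (2 : 𝕂) • m - c • u with hy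
  have hey : ⁅e, y⁆ = 0 := by
    rw [hy, lie_sub, lie_smul, lie_smul,
      two_smul_lie_of_string he heu hefu hfeu hem hefm hfem, sub_self]
  have hfy : ⁅f, y⁆ = 0 := by
    rw [hy, lie_sub, lie_smul, lie_smul,
      two_smul_lie_of_string hf hfu hfeu hefu hfm hfem hefm, sub_self]
  have hry : r y = y := by
    rw [hr, weylOp, LinearMap.comp_apply, LinearMap.comp_apply, locExp_apply_of_one h₁ hey,
      locExp_apply_of_one h₂.neg (by simp [hfy]), locExp_apply_of_one h₁ hey]
  have hm : m = (2 : 𝕂)⁻¹ • (y + c • u) := by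
    rw [hy, sub_add_cancel, smul_smul, inv_mul_cancel₀ two_ne_zero, one_smul]
  have h2 : (2 : 𝕂) • (r m - (m - c • u)) = 0 := by
    nth_rewrite 1 [hm]
    rw [map_smul, map_add, map_smul, hry, hru, smul_sub, smul_smul, mul_inv_cancel₀ two_ne_zero,
      hy]
    module
  exact sub_eq_zero.1 ((smul_eq_zero.1 h2).resolve_left two_ne_zero)

end Weyl

/-! ### Simple root spaces of Lie algebras with Chevalley generators -/

section Chevalley

variable {𝕂 L K : Type*} [Field 𝕂] [LieRing L] [LieAlgebra 𝕂 L]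

/-- The relations between Chevalley generators, without the Serre relations. -/
structure ChevalleyRelations [DecidableEq K] (a : K → K → 𝕂) (E F H : K → L) : Prop where
  lie_H_H : ∀ i j, ⁅H i, H j⁆ = 0
  lie_E_F : ∀ i j, ⁅E i, F j⁆ = if i = j then H j else 0
  lie_H_E : ∀ i j, ⁅H i, E j⁆ = a i j • E j
  lie_H_F : ∀ i j, ⁅H i, F j⁆ = -(a i j • F j)

/-- `IsWord E c x n` means that `x` is an iterated bracket of elements `E k`, nested to the right,
whose weights `c k` add up to `n`. -/
inductive IsWord (E : K → L) (c : K → ℕ) : L → ℕ → Prop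
  | gen (k : K) : IsWord E c (E k) (c k)
  | lie (k : K) {x : L} {n : ℕ} : IsWord E c x n → IsWord E c ⁅E k, x⁆ (c k + n)

/-- The span of the iterated brackets of elements `E k`. -/
def wordSpan (𝕂 : Type*) [Field 𝕂] [LieAlgebra 𝕂 L] (E : K → L) (c : K → ℕ) : Submodule 𝕂 L :=
  Submodule.span 𝕂 {x | ∃ n, IsWord E c x n}

variable {a : K → K → 𝕂} {E F H : K → L} {c : K → ℕ}

/-- The symmetry of the Chevalley involution: each statement about the `E k` also yields one about
the `F k`. -/
theorem ChevalleyRelations.swap [DecidableEq K] (h : ChevalleyRelations a E F H) :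
    ChevalleyRelations a F E (-H) where
  lie_H_H i j := by simp [h.lie_H_H]
  lie_E_F i j := by
    rw [← lie_skew, h.lie_E_F]
    by_cases hij : i = j
    · subst hij; simp
    · simp [hij, Ne.symm hij]
  lie_H_E i j := by simp [h.lie_H_F]
  lie_H_F i j := by simp [h.lie_H_E]

theorem IsWord.lie_eq_smul {d : L} (hd : ∀ k, ⁅d, E k⁆ = (c k : 𝕂) • E k) {x : L} {n : ℕ}
    (hx : IsWord E c x n) : ⁅d, x⁆ = (n : 𝕂) • x := by
  induction hx with
  | gen k => exact hd k
  | lie k hx ih => rw [leibniz_lie, hd, ih, smul_lie, lie_smul, Nat.cast_add, add_smul]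

theorem IsWord.exists_lie_eq_smul {d : L} (hd : ∀ k, ∃ t : 𝕂, ⁅d, E k⁆ = t • E k) {x : L} {n : ℕ}
    (hx : IsWord E c x n) : ∃ t : 𝕂, ⁅d, x⁆ = t • x := by
  induction hx with
  | gen k => exact hd k
  | lie k hx ih =>
    obtain ⟨s, hs⟩ := hd k
    obtain ⟨t, ht⟩ := ih
    exact ⟨s + t, by rw [leibniz_lie, hs, ht, smul_lie, lie_smul, add_smul]⟩

theorem lie_mem_of_span {s : Set L} {S : Submodule 𝕂 L} {d x : L}
    (hx : x ∈ Submodule.span 𝕂 s) (h : ∀ y ∈ s, ⁅d, y⁆ ∈ S) : ⁅d, x⁆ ∈ S :=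
  (Submodule.span_le.2 h : Submodule.span 𝕂 s ≤ S.comap (LieAlgebra.ad 𝕂 L d)) hx

namespace ChevalleyRelations

variable [DecidableEq K] (h : ChevalleyRelations a E F H)
include h

theorem lie_E_mem (k : K) {x : L}
    (hx : x ∈ wordSpan 𝕂 E c ⊔ Submodule.span 𝕂 (Set.range H)) : ⁅E k, x⁆ ∈ wordSpan 𝕂 E c := by
  obtain ⟨y, hy, z, hz, rfl⟩ := Submodule.mem_sup.1 hx
  rw [lie_add]
  refine add_mem (lie_mem_of_span hy ?_) (lie_mem_of_span hz ?_)
  · rintro _ ⟨n, hn⟩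
    exact Submodule.subset_span ⟨_, hn.lie k⟩
  · rintro _ ⟨i, rfl⟩
    rw [← lie_skew, h.lie_H_E]
    exact neg_mem (Submodule.smul_mem _ _ (Submodule.subset_span ⟨_, .gen k⟩))

theorem lie_H_mem (k : K) {x : L} (hx : x ∈ wordSpan 𝕂 E c) : ⁅H k, x⁆ ∈ wordSpan 𝕂 E c := by
  refine lie_mem_of_span hx ?_
  rintro y ⟨n, hn⟩
  obtain ⟨t, ht⟩ := hn.exists_lie_eq_smul fun j => ⟨_, h.lie_H_E k j⟩
  rw [ht]
  exact Submodule.smul_mem _ _ (Submodule.subset_span ⟨_, hn⟩)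

theorem lie_F_mem (l : K) {x : L} (hx : x ∈ wordSpan 𝕂 E c) :
    ⁅F l, x⁆ ∈ wordSpan 𝕂 E c ⊔ Submodule.span 𝕂 (Set.range H) := by
  have hFE : ∀ k, ⁅F l, E k⁆ = -(if k = l then H l else 0) := fun k => by
    rw [← lie_skew, h.lie_E_F]
  refine lie_mem_of_span hx ?_
  rintro y ⟨n, hn⟩
  induction hn with
  | gen k =>
    rw [hFE]
    split_ifs
    · exact neg_mem (Submodule.mem_sup_right (Submodule.subset_span ⟨l, rfl⟩))
    · simp
  | lie k hx ih =>
    rw [leibniz_lie, hFE]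
    refine add_mem ?_ (Submodule.mem_sup_left (h.lie_E_mem k ih))
    split_ifs
    · rw [neg_lie]
      exact neg_mem (Submodule.mem_sup_left (h.lie_H_mem l (Submodule.subset_span ⟨_, hx⟩)))
    · simp

theorem lie_mem_triangular {d x : L} (hd : ∃ k, d = E k ∨ d = F k ∨ d = H k)
    (hx : x ∈ wordSpan 𝕂 E c ⊔ Submodule.span 𝕂 (Set.range H) ⊔ wordSpan 𝕂 F c) :
    ⁅d, x⁆ ∈ wordSpan 𝕂 E c ⊔ Submodule.span 𝕂 (Set.range H) ⊔ wordSpan 𝕂 F c := by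
  have hH : Submodule.span 𝕂 (Set.range (-H)) = Submodule.span 𝕂 (Set.range H) := by
    have : Set.range (-H) = -Set.range H := by
      ext x; simp [Set.mem_range, neg_eq_iff_eq_neg]
    rw [this, Submodule.span_neg]
  obtain ⟨y, hy, z, hz, rfl⟩ := Submodule.mem_sup.1 hx
  rw [lie_add]
  obtain ⟨k, rfl | rfl | rfl⟩ := hd
  · refine add_mem (Submodule.mem_sup_left (Submodule.mem_sup_left (h.lie_E_mem k hy))) ?_
    have := h.swap.lie_F_mem k hz
    rw [hH] at this
    exact (sup_le le_sup_right (le_sup_right.trans le_sup_left) :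
      wordSpan 𝕂 F c ⊔ Submodule.span 𝕂 (Set.range H) ≤ _) this
  · obtain ⟨u, hu, v, hv, rfl⟩ := Submodule.mem_sup.1 hy
    rw [lie_add]
    refine add_mem (add_mem (Submodule.mem_sup_left (h.lie_F_mem k hu)) ?_) ?_ <;>
      refine Submodule.mem_sup_right (h.swap.lie_E_mem k ?_)
    · rw [hH]; exact Submodule.mem_sup_right hv
    · exact Submodule.mem_sup_left hz
  · obtain ⟨u, hu, v, hv, rfl⟩ := Submodule.mem_sup.1 hy
    rw [lie_add]
    refine add_mem (add_mem (Submodule.mem_sup_left (Submodule.mem_sup_left (h.lie_H_mem k hu)))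
      (lie_mem_of_span hv ?_)) (Submodule.mem_sup_right ?_)
    · rintro _ ⟨i, rfl⟩
      rw [h.lie_H_H]
      exact zero_mem _
    · have := neg_mem (h.swap.lie_H_mem k hz)
      rwa [Pi.neg_apply, neg_lie, neg_neg] at this

/-- Only the spanning half of the triangular decomposition is needed; the sum is not claimed to be
direct. -/
theorem lieSpan_le_triangular (c : K → ℕ) {x : L}
    (hx : x ∈ LieSubalgebra.lieSpan 𝕂 L {x | ∃ k, x = E k ∨ x = F k ∨ x = H k}) :
    x ∈ wordSpan 𝕂 E c ⊔ Submodule.span 𝕂 (Set.range H) ⊔ wordSpan 𝕂 F c := by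
  set S := wordSpan 𝕂 E c ⊔ Submodule.span 𝕂 (Set.range H) ⊔ wordSpan 𝕂 F c with hS
  -- The sum `S` is known to be stable only under the generators. Stability under `x` is carried
  -- through the induction, and the bracket case follows by Jacobi.
  suffices x ∈ S ∧ ∀ y ∈ S, ⁅x, y⁆ ∈ S from this.1
  induction hx using LieSubalgebra.lieSpan_induction with
  | mem x hx =>
    refine ⟨?_, fun y hy => h.lie_mem_triangular hx hy⟩
    obtain ⟨k, rfl | rfl | rfl⟩ := hx
    · exact Submodule.mem_sup_left (Submodule.mem_sup_left (Submodule.subset_span ⟨_, .gen k⟩))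
    · exact Submodule.mem_sup_right (Submodule.subset_span ⟨_, .gen k⟩)
    · exact Submodule.mem_sup_left (Submodule.mem_sup_right (Submodule.subset_span ⟨k, rfl⟩))
  | zero => exact ⟨zero_mem _, fun y _ => by simp⟩
  | smul r x _ ih =>
    exact ⟨S.smul_mem r ih.1, fun y hy => by rw [smul_lie]; exact S.smul_mem r (ih.2 y hy)⟩
  | add x y _ _ hx hy =>
    exact ⟨add_mem hx.1 hy.1, fun z hz => by rw [add_lie]; exact add_mem (hx.2 z hz) (hy.2 z hz)⟩
  | lie x y _ _ hx hy =>
    refine ⟨hx.2 y hy.1, fun z hz => ?_⟩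
    rw [lie_lie]
    exact sub_mem (hx.2 _ (hy.2 z hz)) (hy.2 _ (hx.2 z hz))

/-- A simple root space is spanned by the Chevalley generator. -/
theorem mem_span_of_simpleRoot [CharZero 𝕂] [Fintype K] {k : K} {t : K → 𝕂}
    (ht : ∀ j, ∑ l, t l * a l j = if j = k then 1 else 2) {x : L}
    (hx : x ∈ LieSubalgebra.lieSpan 𝕂 L {x | ∃ k, x = E k ∨ x = F k ∨ x = H k})
    (hxk : ∀ l, ⁅H l, x⁆ = a l k • x) : ∃ s : 𝕂, x = s • E k := by
  -- The element `d` grades $\alpha_k$ by $1$ and the other simple roots by $2$. Thus `E k` is the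
  -- only positive word of degree $1$; the `H i` have degree $0$ and negative words have degree $\le
  -- 0$.
  set c : K → ℕ := fun j => if j = k then 1 else 2 with hc
  set d : L := ∑ l, t l • H l with hd
  have hdE : ∀ j, ⁅d, E j⁆ = (c j : 𝕂) • E j := fun j => by
    simp only [hd, sum_lie, smul_lie, h.lie_H_E, smul_smul, ← Finset.sum_smul, ht, hc]
    split_ifs <;> simp
  have hdF : ∀ j, ⁅-d, F j⁆ = (c j : 𝕂) • F j := fun j => by
    simp only [hd, neg_lie, sum_lie, smul_lie, h.lie_H_F, smul_neg, smul_smul,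
      Finset.sum_neg_distrib, neg_neg, ← Finset.sum_smul, ht, hc]
    split_ifs <;> simp
  have hdx : ⁅d, x⁆ = x := by
    simp only [hd, sum_lie, smul_lie, hxk, smul_smul, ← Finset.sum_smul, ht, if_true, one_smul]
  set D : Module.End 𝕂 L := LieAlgebra.ad 𝕂 L d with hD
  set V : Submodule 𝕂 L := ⨆ μ ≠ (1 : 𝕂), D.eigenspace μ with hV
  have hmem : ∀ (y : L) (μ : 𝕂), μ ≠ 1 → ⁅d, y⁆ = μ • y → y ∈ V := fun y μ hμ hy =>
    (le_iSup₂_of_le μ hμ le_rfl : D.eigenspace μ ≤ V) (Module.End.mem_eigenspace_iff.2 hy)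
  have hword : ∀ y n, IsWord E c y n → y = E k ∨ 1 < n := by
    intro y n hy
    have hc1 : ∀ j, 1 ≤ c j := fun j => by simp only [hc]; split_ifs <;> omega
    have hpos : ∀ y n, IsWord E c y n → 1 ≤ n := by
      intro y n hy
      cases hy with
      | gen j => exact hc1 j
      | lie j hy => exact (hc1 j).trans (Nat.le_add_right _ _)
    cases hy with
    | gen j =>
      by_cases hj : j = k
      · exact .inl (by rw [hj])
      · exact .inr (by simp [hc, hj])
    | lie j hy =>
      have h1 := hc1 j
      have h2 := hpos _ _ hy
      exact .inr (by omega)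
  have hle : wordSpan 𝕂 E c ⊔ Submodule.span 𝕂 (Set.range H) ⊔ wordSpan 𝕂 F c ≤
      Submodule.span 𝕂 {E k} ⊔ V := by
    refine sup_le (sup_le (Submodule.span_le.2 ?_) (Submodule.span_le.2 ?_))
      (Submodule.span_le.2 ?_)
    · rintro y ⟨n, hn⟩
      rcases hword y n hn with rfl | h1
      · exact Submodule.mem_sup_left (Submodule.mem_span_singleton_self _)
      · refine Submodule.mem_sup_right (hmem y n ?_ (hn.lie_eq_smul hdE))
        exact_mod_cast h1.ne'
    · rintro _ ⟨i, rfl⟩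
      refine Submodule.mem_sup_right (hmem _ 0 zero_ne_one ?_)
      simp [hd, sum_lie, h.lie_H_H]
    · rintro y ⟨n, hn⟩
      refine Submodule.mem_sup_right (hmem y (-n) ?_ ?_)
      · intro h1
        have h2 : ((n + 1 : ℕ) : 𝕂) = 0 := by rw [Nat.cast_add, Nat.cast_one, ← h1]; ring
        exact Nat.succ_ne_zero n (Nat.cast_eq_zero.1 h2)
      · rw [neg_smul, ← hn.lie_eq_smul hdF, neg_lie, neg_neg]
  -- Both `x` and its component along `E k` have eigenvalue $1$, so the remainder `y` does too. As
  -- `y` also lies in the sum of the other eigenspaces, it is zero.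
  obtain ⟨u, hu, y, hy, rfl⟩ := Submodule.mem_sup.1 (hle (h.lieSpan_le_triangular c hx))
  obtain ⟨s, rfl⟩ := Submodule.mem_span_singleton.1 hu
  have hy1 : y ∈ D.eigenspace 1 := by
    refine Module.End.mem_eigenspace_iff.2 ?_
    rw [lie_add, lie_smul, hdE] at hdx
    simpa [hc, hD] using hdx
  have hy0 := (Submodule.disjoint_def.1 (Module.End.eigenspaces_iSupIndep D 1)) y hy1 hy
  exact ⟨s, by rw [hy0, add_zero]⟩

end ChevalleyRelations

end Chevalley

/-! ### Integrable submodules -/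

section LocallyNilpotentSubmodule

variable {𝕂 L M : Type*} [Field 𝕂] [LieRing L] [LieAlgebra 𝕂 L]
  [AddCommGroup M] [Module 𝕂 M] [LieRingModule L M] [LieModule 𝕂 L M]

theorem expSum_mem {φ : Module.End 𝕂 M} {S : Submodule 𝕂 M} (hS : ∀ m ∈ S, φ m ∈ S) (n : ℕ)
    {m : M} (hm : m ∈ S) : expSum φ n m ∈ S := by
  refine sum_mem fun i hi => S.smul_mem _ ?_
  clear hi
  induction i with
  | zero => exact hm
  | succ i ih => rw [pow_succ', Module.End.mul_apply]; exact hS _ ih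

theorem weylOp_mem {φ ψ : Module.End 𝕂 M} (hφ : IsLocallyNilpotent φ)
    (hψ : IsLocallyNilpotent ψ) {S : Submodule 𝕂 M} (h : ∀ m ∈ S, φ m ∈ S)
    (h' : ∀ m ∈ S, ψ m ∈ S) {m : M} (hm : m ∈ S) : weylOp φ ψ hφ hψ m ∈ S :=
  expSum_mem h _ (expSum_mem (fun m hm => neg_mem (h' m hm)) _ (expSum_mem h _ hm))

/-- The vectors annihilated by a power of every `x ∈ s`, where `s` consists of elements which act
locally nilpotently on the Lie algebra. -/
def nilSubmodule (s : Set L) (hs : ∀ x ∈ s, IsLocallyNilpotent (LieModule.toEnd 𝕂 L L x)) :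
    LieSubmodule 𝕂 L M where
  carrier := {m | ∀ x ∈ s, ∃ n : ℕ, (LieModule.toEnd 𝕂 L M x ^ n) m = 0}
  zero_mem' x _ := ⟨0, by simp⟩
  add_mem' {u v} hu hv x hx := by
    obtain ⟨n, hn⟩ := hu x hx
    obtain ⟨k, hk⟩ := hv x hx
    refine ⟨n + k, ?_⟩
    rw [map_add, pow_apply_eq_zero_of_le (Nat.le_add_right n k) hn,
      pow_apply_eq_zero_of_le (Nat.le_add_left k n) hk, add_zero]
  smul_mem' t u hu x hx := by
    obtain ⟨n, hn⟩ := hu x hx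
    exact ⟨n, by rw [map_smul, hn, smul_zero]⟩
  -- Leibniz: if $x^n$ kills $y$ in the adjoint module and $x^k$ kills $m$, then $x^{n+k}$ kills
  -- $[y,m]$.
  lie_mem {y m} hm x hx := by
    obtain ⟨n, hn⟩ := hs x hx y
    obtain ⟨k, hk⟩ := hm x hx
    exact ⟨n + k, pow_apply_bilin_eq_zero
      (b := (LieModule.toEnd 𝕂 L M : L →ₗ[𝕂] Module.End 𝕂 M))
      (fun u v => leibniz_lie x u v) hn hk⟩

theorem isLocallyNilpotent_nilSubmodule (s : Set L)
    (hs : ∀ x ∈ s, IsLocallyNilpotent (LieModule.toEnd 𝕂 L L x)) {x : L} (hx : x ∈ s) :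
    IsLocallyNilpotent (LieModule.toEnd 𝕂 L (nilSubmodule (M := M) s hs) x) := fun m => by
  obtain ⟨n, hn⟩ := m.2 x hx
  refine ⟨n, Subtype.ext ?_⟩
  rw [LieSubmodule.coe_toEnd_pow, hn]
  rfl

end LocallyNilpotentSubmodule

namespace Datum

variable {𝕂 ι : Type*} [Field 𝕂] [Fintype ι] [DecidableEq ι] (T : Datum 𝕂 ι)

/-! ### The Kac-Moody algebra -/

/-- The quotient map from the free Lie algebra to `𝔤`. -/
def mkHom : FreeLieAlgebra 𝕂 (CartanMatrix.Generators ι) →ₗ⁅𝕂⁆ T.𝔤 :=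
  { (CartanMatrix.Relations.toIdeal 𝕂 T.A).toSubmodule.mkQ with map_lie' := rfl }

theorem mkHom_surjective : Function.Surjective T.mkHom := Submodule.mkQ_surjective _

theorem mkHom_eq_zero {x : FreeLieAlgebra 𝕂 (CartanMatrix.Generators ι)}
    (hx : x ∈ CartanMatrix.Relations.toSet 𝕂 T.A) : T.mkHom x = 0 :=
  (Submodule.Quotient.mk_eq_zero _).2 (LieSubmodule.subset_lieSpan hx)

theorem mkHom_E (i : ι) : T.mkHom (FreeLieAlgebra.of 𝕂 (.E i)) = T.E i := rfl
theorem mkHom_F (i : ι) : T.mkHom (FreeLieAlgebra.of 𝕂 (.F i)) = T.F i := rfl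
theorem mkHom_H (i : ι) : T.mkHom (FreeLieAlgebra.of 𝕂 (.H i)) = T.H i := rfl

theorem mkHom_ad_pow (x y : FreeLieAlgebra 𝕂 (CartanMatrix.Generators ι)) (n : ℕ) :
    T.mkHom ((LieAlgebra.ad 𝕂 _ x ^ n) y) =
      (LieModule.toEnd 𝕂 T.𝔤 T.𝔤 (T.mkHom x) ^ n) (T.mkHom y) := by
  induction n with
  | zero => rfl
  | succ n ih =>
    simp only [pow_succ', Module.End.mul_apply, LieAlgebra.ad_apply, LieHom.map_lie, ih,
      LieModule.toEnd_apply_apply]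

theorem chevalleyRelations :
    ChevalleyRelations (fun i j => (T.A i j : 𝕂)) T.E T.F T.H where
  lie_H_H i j := by
    have h := T.mkHom_eq_zero (x := CartanMatrix.Relations.HH 𝕂 (i, j))
      (by simp [CartanMatrix.Relations.toSet])
    simpa [CartanMatrix.Relations.HH, mkHom_H] using h
  lie_E_F i j := by
    have h := T.mkHom_eq_zero (x := CartanMatrix.Relations.EF 𝕂 (i, j))
      (by simp [CartanMatrix.Relations.toSet])
    by_cases hij : i = j
    · subst hij
      simpa [CartanMatrix.Relations.EF, mkHom_H, mkHom_E, mkHom_F, sub_eq_zero] using h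
    · simpa [CartanMatrix.Relations.EF, mkHom_E, mkHom_F, hij] using h
  lie_H_E i j := by
    have h := T.mkHom_eq_zero (x := CartanMatrix.Relations.HE 𝕂 T.A (i, j))
      (by simp [CartanMatrix.Relations.toSet])
    simpa [CartanMatrix.Relations.HE, mkHom_H, mkHom_E, sub_eq_zero,
      Int.cast_smul_eq_zsmul] using h
  lie_H_F i j := by
    have h := T.mkHom_eq_zero (x := CartanMatrix.Relations.HF 𝕂 T.A (i, j))
      (by simp [CartanMatrix.Relations.toSet])
    simpa [CartanMatrix.Relations.HF, mkHom_H, mkHom_F, add_eq_zero_iff_eq_neg,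
      Int.cast_smul_eq_zsmul] using h

theorem serre_E (i j : ι) :
    (LieModule.toEnd 𝕂 T.𝔤 T.𝔤 (T.E i) ^ ((-T.A i j).toNat + 1)) (T.E j) = 0 := by
  have h := T.mkHom_eq_zero (x := CartanMatrix.Relations.adE 𝕂 T.A (i, j))
    (by simp [CartanMatrix.Relations.toSet])
  rw [pow_succ, Module.End.mul_apply]
  simpa [CartanMatrix.Relations.adE, mkHom_ad_pow, mkHom_E] using h

theorem serre_F (i j : ι) :
    (LieModule.toEnd 𝕂 T.𝔤 T.𝔤 (T.F i) ^ ((-T.A i j).toNat + 1)) (T.F j) = 0 := by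
  have h := T.mkHom_eq_zero (x := CartanMatrix.Relations.adF 𝕂 T.A (i, j))
    (by simp [CartanMatrix.Relations.toSet])
  rw [pow_succ, Module.End.mul_apply]
  simpa [CartanMatrix.Relations.adF, mkHom_ad_pow, mkHom_F] using h

/-- The quotient map from the free Lie algebra factors through `S`, because both maps agree on the
free generators. -/
theorem mem_of_generators {S : LieSubalgebra 𝕂 T.𝔤} (hE : ∀ i, T.E i ∈ S) (hF : ∀ i, T.F i ∈ S)
    (hH : ∀ i, T.H i ∈ S) (x : T.𝔤) : x ∈ S := by
  let g : CartanMatrix.Generators ι → S := fun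
    | .E i => ⟨T.E i, hE i⟩
    | .F i => ⟨T.F i, hF i⟩
    | .H i => ⟨T.H i, hH i⟩
  have h : S.incl.comp (FreeLieAlgebra.lift 𝕂 g) = T.mkHom := FreeLieAlgebra.hom_ext fun x => by
    rw [LieHom.comp_apply, FreeLieAlgebra.lift_of_apply]
    cases x <;> rfl
  obtain ⟨y, rfl⟩ := T.mkHom_surjective x
  rw [← h]
  exact (FreeLieAlgebra.lift 𝕂 g y).2

/-- The elements killed by a power of $\mathrm{ad}\,e_i$ form the Engel subalgebra, so generators
suffice: the $e_j$ by Serre, the $f_j$ by $f_i\mapsto h_i\mapsto e_i\mapsto0$ up to scalars. -/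
theorem isLocallyNilpotent_E (i : ι) :
    IsLocallyNilpotent (LieModule.toEnd 𝕂 T.𝔤 T.𝔤 (T.E i)) := fun x => by
  have hR := T.chevalleyRelations
  refine (LieSubalgebra.mem_engel_iff 𝕂 _ x).1
    (T.mem_of_generators (S := LieSubalgebra.engel 𝕂 (T.E i)) ?_ ?_ ?_ x) <;>
    intro j <;> refine (LieSubalgebra.mem_engel_iff 𝕂 _ _).2 ?_
  · exact ⟨_, T.serre_E i j⟩
  · refine ⟨3, ?_⟩
    simp only [pow_succ, pow_zero, one_mul, Module.End.mul_apply, LieAlgebra.ad_apply, hR.lie_E_F]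
    split_ifs
    · rw [← lie_skew (T.E i) (T.H j), hR.lie_H_E]; simp
    · simp
  · refine ⟨2, ?_⟩
    simp only [pow_succ, pow_zero, one_mul, Module.End.mul_apply, LieAlgebra.ad_apply]
    rw [← lie_skew (T.E i) (T.H j), hR.lie_H_E]; simp

theorem isLocallyNilpotent_F (i : ι) :
    IsLocallyNilpotent (LieModule.toEnd 𝕂 T.𝔤 T.𝔤 (T.F i)) := fun x => by
  have hR := T.chevalleyRelations
  refine (LieSubalgebra.mem_engel_iff 𝕂 _ x).1
    (T.mem_of_generators (S := LieSubalgebra.engel 𝕂 (T.F i)) ?_ ?_ ?_ x) <;>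
    intro j <;> refine (LieSubalgebra.mem_engel_iff 𝕂 _ _).2 ?_
  · refine ⟨3, ?_⟩
    simp only [pow_succ, pow_zero, one_mul, Module.End.mul_apply, LieAlgebra.ad_apply]
    rw [← lie_skew (T.F i) (T.E j), hR.lie_E_F]
    split_ifs
    · rw [lie_neg, ← lie_skew (T.F i) (T.H i), hR.lie_H_F]; simp
    · simp
  · exact ⟨_, T.serre_F i j⟩
  · refine ⟨2, ?_⟩
    simp only [pow_succ, pow_zero, one_mul, Module.End.mul_apply, LieAlgebra.ad_apply]
    rw [← lie_skew (T.F i) (T.H j), hR.lie_H_F]; simp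

theorem lie_lie_E_F_E (i : ι) : ⁅⁅T.E i, T.F i⁆, T.E i⁆ = (2 : 𝕂) • T.E i := by
  rw [T.chevalleyRelations.lie_E_F, if_pos rfl, T.chevalleyRelations.lie_H_E, T.diag]
  norm_num

theorem lie_lie_F_E_F (i : ι) : ⁅⁅T.F i, T.E i⁆, T.F i⁆ = (2 : 𝕂) • T.F i := by
  rw [← lie_skew (T.F i), neg_lie, T.chevalleyRelations.lie_E_F, if_pos rfl,
    T.chevalleyRelations.lie_H_F, T.diag]
  norm_num

theorem chevalleyRelations_K : ChevalleyRelations (fun k l : T.K => (T.A k l : 𝕂))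
    (fun k : T.K => T.E k) (fun k : T.K => T.F k) (fun k : T.K => T.H k) where
  lie_H_H i j := T.chevalleyRelations.lie_H_H i j
  lie_E_F i j := by
    rw [T.chevalleyRelations.lie_E_F]; simp only [Subtype.ext_iff]
  lie_H_E i j := T.chevalleyRelations.lie_H_E i j
  lie_H_F i j := T.chevalleyRelations.lie_H_F i j

theorem E_mem_gMinus (k : T.K) : T.E k ∈ T.gMinus :=
  LieSubalgebra.subset_lieSpan ⟨k, .inl rfl⟩

theorem F_mem_gMinus (k : T.K) : T.F k ∈ T.gMinus :=
  LieSubalgebra.subset_lieSpan ⟨k, .inr (.inl rfl)⟩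

/-! ### Simple root spaces of `𝔤⁻` -/

section SimpleRoots

variable [CharZero 𝕂]

theorem isUnit_det_AK :
    IsUnit (Matrix.of fun k l : T.K => (T.A k l : 𝕂)).det := by
  have h : (Matrix.of fun k l : T.K => (T.A k l : 𝕂)) =
      (Int.castRingHom 𝕂).mapMatrix
        (T.A.submatrix (Subtype.val : T.K → ι) Subtype.val) := by
    ext k l; simp
  rw [h, ← RingHom.map_det, isUnit_iff_ne_zero]
  simpa using T.det_AK_ne_zero

/-- Since $(A_{kl})_{k,l\in K}$ is invertible, $\mathfrak h^-$ has an element taking prescribed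
values on the simple roots; this supplies the grading element for simple root spaces. -/
theorem exists_sum_mul_eq (c : T.K → 𝕂) :
    ∃ t : T.K → 𝕂, ∀ j : T.K, ∑ l, t l * (T.A l j : 𝕂) = c j := by
  refine ⟨Matrix.vecMul c (Matrix.of fun k l : T.K => (T.A k l : 𝕂))⁻¹, fun j => ?_⟩
  have h := Matrix.vecMul_vecMul c (Matrix.of fun k l : T.K => (T.A k l : 𝕂))⁻¹
    (Matrix.of fun k l : T.K => (T.A k l : 𝕂))
  rw [Matrix.nonsing_inv_mul _ T.isUnit_det_AK, Matrix.vecMul_one] at h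
  exact congrFun h j

theorem exists_eq_smul_E {k : T.K} {x : T.𝔤} (hx : x ∈ T.rootSpace (T.simpleRoot k)) :
    ∃ s : 𝕂, x = s • T.E k := by
  obtain ⟨t, ht⟩ := T.exists_sum_mul_eq fun j => if j = k then 1 else 2
  exact T.chevalleyRelations_K.mem_span_of_simpleRoot ht hx.1 hx.2

theorem exists_eq_smul_F {k : T.K} {x : T.𝔤} (hx : x ∈ T.rootSpace (-T.simpleRoot k)) :
    ∃ s : 𝕂, x = s • T.F k := by
  obtain ⟨t, ht⟩ := T.exists_sum_mul_eq fun j => if j = k then 1 else 2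
  refine T.chevalleyRelations_K.swap.mem_span_of_simpleRoot ht ?_ fun l => ?_
  · refine (LieSubalgebra.lieSpan_le.2 ?_ : T.gMinus ≤ _) hx.1
    rintro _ ⟨k, rfl | rfl | rfl⟩
    · exact LieSubalgebra.subset_lieSpan ⟨k, .inr (.inl rfl)⟩
    · exact LieSubalgebra.subset_lieSpan ⟨k, .inl rfl⟩
    · rw [← neg_neg (T.H k)]
      exact neg_mem (LieSubalgebra.subset_lieSpan ⟨k, .inr (.inr rfl)⟩)
  · have := hx.2 l
    simp [simpleRoot, this]

end SimpleRoots

/-! ### Weights -/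

/-- The number `(μ, α_k)` for a weight `μ`, in terms of the coefficients of `μ`. -/
def rootPairing (μ : T.Weight) (k : T.K) : 𝕂 := ∑ i, T.coeff μ i * (T.A i k : 𝕂)

/-- The linear combination of a family of vectors with the same coefficients as `μ` has in the
basis `α_k^∨`. -/
def comb {M : Type*} [AddCommGroup M] [Module 𝕂 M] (v : T.K → M) : T.Weight →ₗ[𝕂] M where
  toFun μ := ∑ k, T.coeff μ k • v k
  map_add' μ ν := by simp [coeff, Matrix.add_vecMul, add_smul, Finset.sum_add_distrib]
  map_smul' t μ := by simp [coeff, Matrix.smul_vecMul, Finset.smul_sum, smul_smul]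

section Comb

variable {M : Type*} [AddCommGroup M] [Module 𝕂 M] (v : T.K → M)

theorem comb_apply (μ : T.Weight) : T.comb v μ = ∑ k, T.coeff μ k • v k := rfl

theorem comb_simpleCheck [CharZero 𝕂] (k : T.K) : T.comb v (T.simpleCheck k) = v k := by
  have hdet : IsUnit (Matrix.of T.simpleCheck).det := by
    have h1 : Matrix.of T.simpleCheck = Matrix.diagonal (fun k : T.K => T.ε k) *
        (Matrix.of fun k l : T.K => (T.A k l : 𝕂)).transpose := by
      ext k l
      simp [simpleCheck, simpleRoot, Matrix.diagonal_mul]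
    rw [h1, Matrix.det_mul, Matrix.det_diagonal, Matrix.det_transpose]
    refine IsUnit.mul (isUnit_iff_ne_zero.2 ?_) T.isUnit_det_AK
    exact Finset.prod_ne_zero_iff.2 fun k _ => T.ε_ne_zero k
  have h : T.coeff (T.simpleCheck k) = (1 : Matrix T.K T.K 𝕂) k := by
    rw [← Matrix.mul_nonsing_inv _ hdet, Matrix.mul_apply_eq_vecMul]
    rfl
  rw [comb_apply, h]
  simp [Matrix.one_apply]

theorem comb_simpleRoot [CharZero 𝕂] (k : T.K) :
    T.comb v (T.simpleRoot k) = (T.ε k)⁻¹ • v k := by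
  rw [← T.comb_simpleCheck v k, ← map_smul, simpleCheck, smul_smul,
    inv_mul_cancel₀ (T.ε_ne_zero k), one_smul]

end Comb

theorem weylReflection_apply (k : T.K) (μ : T.Weight) :
    T.weylReflection k μ = μ - μ k • T.simpleRoot k := by
  simp [weylReflection, Module.reflection_apply]

theorem weylReflection_weylReflection (k : T.K) (μ : T.Weight) :
    T.weylReflection k (T.weylReflection k μ) = μ :=
  Module.involutive_reflection (T.simpleRoot_self k) μ

variable [CharZero 𝕂]

/-- The symmetry of $D^{-1}A$ in the form $\epsilon_iA_{ki}=\epsilon_kA_{ik}$, summed against the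
coefficients of $\mu$. -/
theorem apply_eq_mul_rootPairing (μ : T.Weight) (k : T.K) : μ k = T.ε k * T.rootPairing μ k := by
  conv_lhs => rw [← T.sum_coeff μ]
  rw [Finset.sum_apply, rootPairing, Finset.mul_sum]
  refine Finset.sum_congr rfl fun i _ => ?_
  have h := T.symm i k
  have h1 := T.ε_ne_zero i
  have h2 := T.ε_ne_zero k
  simp only [simpleCheck, simpleRoot, Pi.smul_apply, smul_eq_mul]
  field_simp at h
  linear_combination -(T.coeff μ i) * h

theorem comb_weylReflection {M : Type*} [AddCommGroup M] [Module 𝕂 M] (v : T.K → M) (k : T.K)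
    (μ : T.Weight) :
    T.comb v (T.weylReflection k μ) = T.comb v μ - T.rootPairing μ k • v k := by
  rw [weylReflection_apply, map_sub, map_smul, comb_simpleRoot, smul_smul,
    T.apply_eq_mul_rootPairing μ k, mul_right_comm, mul_inv_cancel₀ (T.ε_ne_zero k), one_mul]

/-! ### The invariant form -/

section Form

variable {T} {κ : LinearMap.BilinForm 𝕂 T.𝔤} (hκ : T.IsForm κ)
include hκ

theorem IsForm.apply_H_H (i j : ι) : κ (T.H i) (T.H j) = T.A i j * T.ε j := by
  have h : T.H j = ⁅T.E j, T.F j⁆ := by rw [T.chevalleyRelations.lie_E_F, if_pos rfl]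
  rw [h, ← hκ.invariant, T.chevalleyRelations.lie_H_E, map_smul, LinearMap.smul_apply,
    hκ.apply_E_F, if_pos rfl, smul_eq_mul]

theorem IsForm.pairing_simpleRoot (μ : T.Weight) (k : T.K) :
    T.pairing κ μ (T.simpleRoot k) = T.rootPairing μ k := by
  change κ (T.comb (fun k : T.K => T.H k) μ) (T.comb (fun k : T.K => T.H k) (T.simpleRoot k)) = _
  rw [comb_simpleRoot, map_smul, comb_apply, map_sum, LinearMap.sum_apply, Finset.smul_sum,
    rootPairing]
  refine Finset.sum_congr rfl fun i _ => ?_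
  rw [map_smul, LinearMap.smul_apply, hκ.apply_H_H, smul_eq_mul, smul_eq_mul]
  have := T.ε_ne_zero k
  field_simp

end Form

/-! ### Families of vectors on which `𝔤⁻` acts as on the `h_k` -/

/-- The relations satisfied by the elements `h_k` of the adjoint module, and by the elements `f_{0k}`
of `W`. -/
structure IsCartanFamily {M : Type*} [AddCommGroup M] [Module 𝕂 M] [LieRingModule T.𝔤 M]
    (v : T.K → M) : Prop where
  lie_E_E : ∀ k i : T.K, ⁅T.E k, ⁅T.E k, v i⁆⁆ = 0
  lie_F_F : ∀ k i : T.K, ⁅T.F k, ⁅T.F k, v i⁆⁆ = 0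
  lie_E_F : ∀ k i : T.K, ⁅T.E k, ⁅T.F k, v i⁆⁆ = (T.A i k : 𝕂) • v k
  lie_F_E : ∀ k i : T.K, ⁅T.F k, ⁅T.E k, v i⁆⁆ = (T.A i k : 𝕂) • v k

theorem isCartanFamily_H : T.IsCartanFamily (fun k : T.K => T.H k) := by
  have hR := T.chevalleyRelations
  have hE : ∀ k i : T.K, ⁅T.E k, T.H i⁆ = -((T.A i k : 𝕂) • T.E k) := fun k i => by
    rw [← lie_skew, hR.lie_H_E]
  have hF : ∀ k i : T.K, ⁅T.F k, T.H i⁆ = (T.A i k : 𝕂) • T.F k := fun k i => by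
    rw [← lie_skew, hR.lie_H_F, neg_neg]
  constructor <;> intro k i
  · simp [hE]
  · simp [hF]
  · simp [hF, hR.lie_E_F]
  · rw [hE, lie_neg, lie_smul, ← lie_skew, hR.lie_E_F]
    simp

/-! ### Reflections on integrable modules -/

section Module

variable {T} {M : Type*} [AddCommGroup M] [Module 𝕂 M] [LieRingModule T.𝔤 M] [LieModule 𝕂 T.𝔤 M]
  {v : T.K → M} (hv : T.IsCartanFamily v)
  (hE : ∀ k : T.K, IsLocallyNilpotent (LieModule.toEnd 𝕂 T.𝔤 M (T.E k)))
  (hF : ∀ k : T.K, IsLocallyNilpotent (LieModule.toEnd 𝕂 T.𝔤 M (T.F k)))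

section

include hv

theorem IsCartanFamily.two_smul_lie_E (k i : T.K) :
    (2 : 𝕂) • ⁅T.E k, v i⁆ = (T.A i k : 𝕂) • ⁅T.E k, v k⁆ := by
  have h2 : (T.A k k : 𝕂) = 2 := by rw [T.diag]; norm_num
  exact two_smul_lie_of_string (T.lie_lie_E_F_E k) (hv.lie_E_E k k)
    (by rw [hv.lie_E_F, h2]) (by rw [hv.lie_F_E, h2]) (hv.lie_E_E k i) (hv.lie_E_F k i)
    (hv.lie_F_E k i)

/-- The bracket depends on $\mu$ only through the scalar $(\mu,\alpha_k)$, which is the third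
identity for a simple root. -/
theorem IsCartanFamily.lie_E_comb (k : T.K) (μ : T.Weight) :
    ⁅T.E k, T.comb v μ⁆ = T.rootPairing μ k • (2 : 𝕂)⁻¹ • ⁅T.E k, v k⁆ := by
  rw [comb_apply, lie_sum, rootPairing, Finset.sum_smul]
  refine Finset.sum_congr rfl fun i _ => ?_
  rw [lie_smul, mul_smul, smul_comm (T.A i k : 𝕂), ← hv.two_smul_lie_E, smul_smul (2 : 𝕂)⁻¹,
    inv_mul_cancel₀ two_ne_zero, one_smul]

theorem IsCartanFamily.lie_E_lie_F_comb (k : T.K) (μ : T.Weight) :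
    ⁅T.E k, ⁅T.F k, T.comb v μ⁆⁆ = T.rootPairing μ k • v k := by
  rw [comb_apply, lie_sum, lie_sum, rootPairing, Finset.sum_smul]
  refine Finset.sum_congr rfl fun i _ => ?_
  rw [lie_smul, lie_smul, hv.lie_E_F, smul_smul]

end

/-- The action of the fundamental reflection for `k` on an integrable `𝔤`-module. -/
def moduleReflection (k : T.K) : M →ₗ[𝕂] M :=
  weylOp (LieModule.toEnd 𝕂 T.𝔤 M (T.E k)) (LieModule.toEnd 𝕂 T.𝔤 M (T.F k)) (hE k) (hF k)

variable (T) in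
/-- The action of the fundamental reflection for `k` on `𝔤`. -/
def adjointReflection (k : T.K) : T.𝔤 →ₗ[𝕂] T.𝔤 :=
  moduleReflection (M := T.𝔤) (fun k => T.isLocallyNilpotent_E k)
    (fun k => T.isLocallyNilpotent_F k) k

theorem moduleReflection_injective (k : T.K) :
    Function.Injective (moduleReflection hE hF k) := weylOp_injective _ _

theorem moduleReflection_lie (k : T.K) (x : T.𝔤) (m : M) :
    moduleReflection hE hF k ⁅x, m⁆ =
      ⁅T.adjointReflection k x, moduleReflection hE hF k m⁆ :=
  weylOp_bilin (b := (LieModule.toEnd 𝕂 T.𝔤 M : T.𝔤 →ₗ[𝕂] Module.End 𝕂 M))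
    (fun u v => leibniz_lie (T.E k) u v) (fun u v => leibniz_lie (T.F k) u v)
    (T.isLocallyNilpotent_E k) (T.isLocallyNilpotent_F k) (hE k) (hF k) (hE k) (hF k) x m

include hv in
theorem moduleReflection_family (k i : T.K) :
    moduleReflection hE hF k (v i) = v i - (T.A i k : 𝕂) • v k := by
  have h2 : (T.A k k : 𝕂) = 2 := by rw [T.diag]; norm_num
  exact weylOp_apply_of_string (T.lie_lie_E_F_E k) (T.lie_lie_F_E_F k) (hv.lie_E_E k k)
    (hv.lie_F_F k k) (by rw [hv.lie_E_F, h2]) (by rw [hv.lie_F_E, h2]) (hv.lie_E_E k i)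
    (hv.lie_F_F k i) (hv.lie_E_F k i) (hv.lie_F_E k i) (hE k) (hF k)

include hv in
theorem moduleReflection_comb (k : T.K) (μ : T.Weight) :
    moduleReflection hE hF k (T.comb v μ) = T.comb v (T.weylReflection k μ) := by
  rw [comb_weylReflection, comb_apply, map_sum, rootPairing, Finset.sum_smul,
    ← Finset.sum_sub_distrib]
  refine Finset.sum_congr rfl fun i _ => ?_
  rw [map_smul, moduleReflection_family hv, smul_sub, smul_smul]

theorem adjointReflection_lie (k : T.K) (x y : T.𝔤) :
    T.adjointReflection k ⁅x, y⁆ = ⁅T.adjointReflection k x, T.adjointReflection k y⁆ :=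
  moduleReflection_lie _ _ k x y

theorem adjointReflection_H (k i : T.K) :
    T.adjointReflection k (T.H i) = T.H i - (T.A i k : 𝕂) • T.H k :=
  moduleReflection_family T.isCartanFamily_H _ _ k i

theorem adjointReflection_hCheck (k : T.K) (μ : T.Weight) :
    T.adjointReflection k (T.hCheck μ) = T.hCheck (T.weylReflection k μ) :=
  moduleReflection_comb T.isCartanFamily_H _ _ k μ

theorem adjointReflection_mem_rootSpace (k : T.K) {β : T.Weight} {x : T.𝔤}
    (hx : x ∈ T.rootSpace β) : T.adjointReflection k x ∈ T.rootSpace (T.weylReflection k β) := by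
  refine ⟨weylOp_mem (S := T.gMinus.toSubmodule)
    (T.isLocallyNilpotent_E k) (T.isLocallyNilpotent_F k)
    (fun m hm => T.gMinus.lie_mem (T.E_mem_gMinus k) hm)
    (fun m hm => T.gMinus.lie_mem (T.F_mem_gMinus k) hm) hx.1, fun l => ?_⟩
  -- The reflection squares to the identity on the span of the $h_l$, so $h_l$ is the image of its
  -- own reflection.
  have h : T.H l = T.adjointReflection k (T.H l - (T.A l k : 𝕂) • T.H k) := by
    rw [map_sub, map_smul, adjointReflection_H, adjointReflection_H, T.diag]
    push_cast
    module
  rw [h, ← adjointReflection_lie, sub_lie, smul_lie, hx.2, hx.2, smul_smul, ← sub_smul, map_smul,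
    weylReflection_apply, Pi.sub_apply, Pi.smul_apply, smul_eq_mul, simpleRoot, mul_comm]

/-- Invariance says that $\kappa$ intertwines the adjoint action with the zero action on $\mathbb
K$, whose exponentials are the identity. -/
theorem IsForm.apply_adjointReflection {κ : LinearMap.BilinForm 𝕂 T.𝔤} (hκ : T.IsForm κ)
    (k : T.K) (x y : T.𝔤) :
    κ (T.adjointReflection k x) (T.adjointReflection k y) = κ x y := by
  have hinv : ∀ d x y : T.𝔤, (0 : Module.End 𝕂 𝕂) (κ x y) =
      κ (LieModule.toEnd 𝕂 T.𝔤 T.𝔤 d x) y + κ x (LieModule.toEnd 𝕂 T.𝔤 T.𝔤 d y) := fun d x y => by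
    rw [LieModule.toEnd_apply_apply, LieModule.toEnd_apply_apply, ← hκ.invariant, ← lie_skew d x,
      map_neg, LinearMap.neg_apply, LinearMap.zero_apply, neg_add_cancel]
  have h0 := isLocallyNilpotent_zero (𝕂 := 𝕂) (M := 𝕂)
  have h := weylOp_bilin (hinv (T.E k)) (hinv (T.F k)) (T.isLocallyNilpotent_E k)
    (T.isLocallyNilpotent_F k) (T.isLocallyNilpotent_E k) (T.isLocallyNilpotent_F k) h0 h0 x y
  refine h.symm.trans ?_
  rw [weylOp, LinearMap.comp_apply, LinearMap.comp_apply, locExp_apply_of_one _ (by simp),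
    locExp_apply_of_one _ (by simp), locExp_apply_of_one _ (by simp)]

theorem IsForm.pairing_weylReflection {κ : LinearMap.BilinForm 𝕂 T.𝔤} (hκ : T.IsForm κ) (k : T.K)
    (μ ν : T.Weight) :
    T.pairing κ (T.weylReflection k μ) (T.weylReflection k ν) = T.pairing κ μ ν := by
  rw [pairing, ← adjointReflection_hCheck, ← adjointReflection_hCheck,
    hκ.apply_adjointReflection, pairing]

/-! ### The three identities and their transport by the Weyl group -/

variable (T) in
/-- The identities relating the root vectors for `±α` with a family of vectors. -/
def RootIdentities (κ : LinearMap.BilinForm 𝕂 T.𝔤) (v : T.K → M) (α : T.Weight) : Prop :=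
  ∀ x ∈ T.rootSpace α, ∀ y ∈ T.rootSpace (-α), ∀ μ ν : T.Weight,
    ⁅x, ⁅x, T.comb v μ⁆⁆ = 0 ∧
    ⁅x, ⁅y, T.comb v μ⁆⁆ = T.pairing κ μ α • T.comb v (κ x y • α) ∧
    T.pairing κ μ α • ⁅x, T.comb v ν⁆ = T.pairing κ ν α • ⁅x, T.comb v μ⁆

variable {κ : LinearMap.BilinForm 𝕂 T.𝔤} (hκ : T.IsForm κ)

include hκ hv in
theorem rootIdentities_simpleRoot (k : T.K) : T.RootIdentities κ v (T.simpleRoot k) := by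
  intro x hx y hy μ ν
  obtain ⟨s, rfl⟩ := T.exists_eq_smul_E hx
  obtain ⟨t, rfl⟩ := T.exists_eq_smul_F hy
  simp only [hκ.pairing_simpleRoot, smul_lie, lie_smul, hv.lie_E_lie_F_comb, hv.lie_E_comb,
    hv.lie_E_E, map_smul, LinearMap.smul_apply, hκ.apply_E_F, if_true, comb_simpleRoot]
  refine ⟨by simp, ?_, ?_⟩
  · simp only [smul_smul, smul_eq_mul]
    congr 1
    have := T.ε_ne_zero k
    field_simp
  · simp only [smul_smul]
    congr 1
    ring

-- Applying the injective reflection to an identity for $s_k\alpha$ turns it into one for $\alpha$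
-- with reflected root vectors and weights. Quantifying over all root vectors and weights makes the
-- hypothesis apply directly.
include hκ hv hE hF in
theorem RootIdentities.weylReflection {α : T.Weight} (h : T.RootIdentities κ v α) (k : T.K) :
    T.RootIdentities κ v (T.weylReflection k α) := by
  intro x hx y hy μ ν
  have hx' := adjointReflection_mem_rootSpace k hx
  have hy' := adjointReflection_mem_rootSpace k hy
  rw [map_neg, weylReflection_weylReflection] at hy'
  rw [weylReflection_weylReflection] at hx'
  obtain ⟨h1, h2, h3⟩ := h _ hx' _ hy' (T.weylReflection k μ) (T.weylReflection k ν)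
  have hp : ∀ μ, T.pairing κ (T.weylReflection k μ) α =
      T.pairing κ μ (T.weylReflection k α) := fun μ => by
    rw [← hκ.pairing_weylReflection k μ, weylReflection_weylReflection]
  have hinj := moduleReflection_injective hE hF k
  refine ⟨hinj ?_, hinj ?_, hinj ?_⟩
  · rw [moduleReflection_lie, moduleReflection_lie, moduleReflection_comb hv, h1, map_zero]
  · rw [moduleReflection_lie, moduleReflection_lie, moduleReflection_comb hv, h2, hp, hκ.apply_adjointReflection, map_smul (T.comb v), map_smul,
      map_smul (T.comb v), map_smul, moduleReflection_comb hv, weylReflection_weylReflection]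
  · rw [map_smul, map_smul, moduleReflection_lie, moduleReflection_lie, moduleReflection_comb hv,
      moduleReflection_comb hv, ← hp, ← hp, h3]

include hκ hv hE hF in
theorem rootIdentities_of_isRealRoot {α : T.Weight} (hα : T.IsRealRoot α) :
    T.RootIdentities κ v α := by
  obtain ⟨w, hw, k, rfl⟩ := hα
  -- An equivalence for all $\beta$ passes to products and inverses in the Weyl group.
  suffices ∀ β, T.RootIdentities κ v (w β) ↔ T.RootIdentities κ v β from
    (this _).2 (rootIdentities_simpleRoot hv hκ k)
  rw [weylGroup] at hw
  induction hw using Subgroup.closure_induction with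
  | mem w hw =>
    obtain ⟨k, rfl⟩ := hw
    intro β
    refine ⟨fun h => ?_, fun h => h.weylReflection hv hE hF hκ k⟩
    simpa only [weylReflection_weylReflection] using h.weylReflection hv hE hF hκ k
  | one => exact fun β => Iff.rfl
  | mul x y _ _ hx hy => exact fun β => (hx (y β)).trans (hy β)
  | inv x _ hx =>
    intro β
    rw [← hx (x⁻¹ β)]
    exact iff_of_eq (congrArg _ (x.apply_symm_apply β))

end Module

/-! ### The module `W` -/

section Hierarchy

theorem incl_mem (x : T.𝔤) : T.incl x ∈ T.superW.piece 0 := (T.toWZero x).2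

instance : LieRingModule T.𝔤 T.W where
  bracket x m := ⁅T.incl x, m⁆
  add_lie x y m := by
    change T.superW.bracket _ _ = T.superW.bracket _ _ + T.superW.bracket _ _
    rw [map_add, map_add, LinearMap.add_apply]
  lie_add x m n := map_add (T.superW.bracket (T.incl x)) m n
  leibniz_lie x y m := by
    change ⁅T.incl x, ⁅T.incl y, m⁆⁆ = ⁅T.incl ⁅x, y⁆, m⁆ + ⁅T.incl y, ⁅T.incl x, m⁆⁆
    rw [incl_lie]
    -- Both elements have degree $0$, so the super Jacobi identity has no sign.
    have h := T.superW.jacobi m (T.incl_mem x) (T.incl_mem y)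
    rwa [show sgn 𝕂 0 0 = 1 by simp [sgn], one_smul] at h

theorem lie_W_def (x : T.𝔤) (m : T.W) : ⁅x, m⁆ = ⁅T.incl x, m⁆ := rfl

instance : LieModule 𝕂 T.𝔤 T.W where
  smul_lie t x m := by
    change T.superW.bracket _ _ = t • T.superW.bracket _ _
    rw [map_smul, map_smul, LinearMap.smul_apply]
  lie_smul t x m := map_smul (T.superW.bracket (T.incl x)) t m

/-- The element `f_{0k}` of `W`. -/
def f0 (k : T.K) : T.W := T.toW (T.gen (.f0 (some k)))

/-- The weight vanishes because $B_{i0}=-\lambda_i=0$ for $i\in K$. Consequently $e_kf_k$ and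
$f_ke_k$ agree on the $f_{0i}$. -/
theorem lie_H_f0 (i k : T.K) : ⁅T.H i, T.f0 k⁆ = 0 := by
  have h := T.toW_rel (Rel.h_f0 (T := T) (some i) (some k))
  rw [toW_mul, ← incl_H] at h
  refine h.trans ?_
  simp [B, extendedMatrix, i.2]

theorem isCartanFamily_f0 : T.IsCartanFamily T.f0 := by
  have hEF : ∀ k i : T.K, ⁅T.E k, ⁅T.F k, T.f0 i⁆⁆ = (T.A i k : 𝕂) • T.f0 k := fun k i => by
    have h := T.toW_rel (Rel.e_f_f0 (T := T) k k (some i))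
    rw [toW_mul, toW_mul, ← incl_E, ← incl_F] at h
    refine h.trans ?_
    simp [B, extendedMatrix, f0]
  refine ⟨fun k i => ?_, fun k i => ?_, hEF, fun k i => ?_⟩
  · have h := T.toW_rel (Rel.e_e_f0 (T := T) k (some i))
    rw [toW_mul, toW_mul, ← incl_E, map_zero] at h
    exact h
  · have h := T.toW_rel (Rel.f_f_f0 (T := T) k (some i))
    rw [toW_mul, toW_mul, ← incl_F, map_zero] at h
    exact h
  · have h := lie_lie (T.E k) (T.F k) (T.f0 i)
    rw [T.chevalleyRelations.lie_E_F, if_pos rfl, lie_H_f0, hEF] at h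
    exact (sub_eq_zero.1 h.symm).symm

/-- The Chevalley generators `e_k` and `f_k` of `𝔤⁻`. -/
def nilGenerators : Set T.𝔤 := {x | ∃ k : T.K, x = T.E k ∨ x = T.F k}

theorem isLocallyNilpotent_of_mem {x : T.𝔤} (hx : x ∈ T.nilGenerators) :
    IsLocallyNilpotent (LieModule.toEnd 𝕂 T.𝔤 T.𝔤 x) := by
  obtain ⟨k, rfl | rfl⟩ := hx
  · exact T.isLocallyNilpotent_E k
  · exact T.isLocallyNilpotent_F k

/-- The submodule of `W` on which the Chevalley generators of `𝔤⁻` act locally nilpotently. -/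
def integrablePart : LieSubmodule 𝕂 T.𝔤 T.W :=
  nilSubmodule T.nilGenerators fun _ hx => T.isLocallyNilpotent_of_mem hx

theorem f0_mem_integrablePart (i : T.K) : T.f0 i ∈ T.integrablePart := by
  rintro _ ⟨k, rfl | rfl⟩ <;> refine ⟨2, ?_⟩
  · simpa [pow_succ] using T.isCartanFamily_f0.lie_E_E k i
  · simpa [pow_succ] using T.isCartanFamily_f0.lie_F_F k i

/-- The element `f_{0k}` of the integrable part of `W`. -/
def f0Int (k : T.K) : T.integrablePart := ⟨T.f0 k, T.f0_mem_integrablePart k⟩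

theorem isCartanFamily_f0Int : T.IsCartanFamily T.f0Int where
  lie_E_E k i := Subtype.ext (T.isCartanFamily_f0.lie_E_E k i)
  lie_F_F k i := Subtype.ext (T.isCartanFamily_f0.lie_F_F k i)
  lie_E_F k i := Subtype.ext (T.isCartanFamily_f0.lie_E_F k i)
  lie_F_E k i := Subtype.ext (T.isCartanFamily_f0.lie_F_E k i)

theorem coe_comb_f0Int (μ : T.Weight) : (T.comb T.f0Int μ : T.W) = T.f0Check μ := by
  rw [comb_apply]
  exact map_sum T.integrablePart.toSubmodule.subtype _ _

end Hierarchy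

end Datum

end THA

end

theorem proposition2p4 {𝕂 ι : Type*} [Field 𝕂] [IsAlgClosed 𝕂] [CharZero 𝕂] [Fintype ι]
    [DecidableEq ι] (T : THA.Datum 𝕂 ι) (κ : LinearMap.BilinForm 𝕂 T.𝔤) (hκ : T.IsForm κ)
    (α : T.Weight) (hα : T.IsRealRoot α)
    (eα : T.𝔤) (heα : eα ∈ T.rootSpace α) (eα' : T.𝔤) (heα' : eα' ∈ T.rootSpace (-α))
    (μ ν : T.Weight) :
    ⁅T.incl eα, ⁅T.incl eα, T.f0Check μ⁆⁆ = 0 ∧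
    ⁅T.incl eα, ⁅T.incl eα', T.f0Check μ⁆⁆ =
      T.pairing κ μ α • T.f0Check (κ eα eα' • α) ∧
    T.pairing κ μ α • ⁅T.incl eα, T.f0Check ν⁆ =
      T.pairing κ ν α • ⁅T.incl eα, T.f0Check μ⁆ := by
  -- The identities are proved in the integrable submodule, where the reflections exist, and then
  -- read in $W$.
  obtain ⟨h1, h2, h3⟩ := THA.Datum.rootIdentities_of_isRealRoot T.isCartanFamily_f0Int
    (fun k => THA.isLocallyNilpotent_nilSubmodule _ _ ⟨k, .inl rfl⟩)
    (fun k => THA.isLocallyNilpotent_nilSubmodule _ _ ⟨k, .inr rfl⟩) hκ hα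
    eα heα eα' heα' μ ν
  have h1' := congrArg Subtype.val h1
  have h2' := congrArg Subtype.val h2
  have h3' := congrArg Subtype.val h3
  simp only [LieSubmodule.coe_bracket, LieSubmodule.coe_smul, T.coe_comb_f0Int] at h1' h2' h3'
  exact ⟨h1', h2', h3'⟩
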